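/- Let $\mathcal H$ be a complex Hilbert space and $A$ a self-adjoint (in general unbounded) operator in $\mathcal H$ with domain $D(A)$. Let $\mathcal D=\mathcal D^\infty(A)=\bigcap_{n\ge 0}D(A^n)$ carry the locally convex topology given by the seminorms $\xi\mapsto\|A^n\xi\|$, $n\ge 0$, let $\mathcal D^\times$ be the space of continuous conjugate linear functionals on $\mathcal D$ with the strong dual topology, and identify $\mathcal D\subset\mathcal H\subset\mathcal D^\times$ by letting $\xi\in\mathcal H$ act on $\mathcal D$ as $\eta\mapsto\langle\xi,\eta\rangle$, where $\langle\cdot,\cdot\rangle$ is the inner product of $\mathcal H$, linear in its first variable. Let $S=A\restriction_{\mathcal D}$, regarded as a continuous linear map $\mathcal D\to\mathcal D^\times$. Put $\mathcal H_0=\mathcal H$; for $n\ge 1$ let $\mathcal H_n$ be $D(A^n)$ with its graph norm $\|\xi\|_n=\|(I+A^{2n})^{1/2}\xi\|=(\|\xi\|^2+\|A^n\xi\|^2)^{1/2}$, and let $\mathcal H_{-n}$ be the completion of $\mathcal H$ with respect to the norm $\|\xi\|_{-n}=\|(I+A^{2n})^{-1/2}\xi\|$. All these Hilbert spaces are regarded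 as subspaces of $\mathcal D^\times$ containing $\mathcal D$ as a dense subspace; let $\mathfrak F_0=\{\mathcal H_n : n\in\mathbb Z\}$. For $\mathcal E,\mathcal F\in\mathfrak F_0$ and a continuous linear map $X:\mathcal D\to\mathcal D^\times$ write $X\in\mathcal C(\mathcal E,\mathcal F)$ if there is a (necessarily unique) bounded operator $X_{\mathcal E}:\mathcal E\to\mathcal F$ with $X_{\mathcal E}\xi=X\xi$ for all $\xi\in\mathcal D$. If $\mathcal E\subseteq\mathcal F$ and $X\in\mathcal C(\mathcal E,\mathcal F)$, let $I_{\mathcal E}$ be the identity map of $\mathcal E$, viewed as a map into $\mathcal F$, and let $\varrho_{\mathcal E,\mathcal F}(X)$ be the set of $\lambda\in\mathbb C$ such that $X_{\mathcal E}-\lambda I_{\mathcal E}:\mathcal E\to\mathcal F$ has a bounded inverse $\mathcal F\to\mathcal E$; otherwise put $\varrho_{\mathcal E,\mathcal F}(X)=\emptyset$. Write $\varrho_{n,m}(S)=\varrho_{\mathcal H_n,\mathcal H_m}(S)$. The $\mathfrak F_0$-resolvent set $\varrho^{\mathfrak F_0}(X)$ is the set of $\lambda\in\mathbb C$ for which there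 exist $\mathcal E,\mathcal F\in\mathfrak F_0$ with $\mathcal E\subseteq\mathcal F$ and $X\in\mathcal C(\mathcal E,\mathcal F)$, such that $(X_{\mathcal E}-\lambda I_{\mathcal E})\mathcal E=\mathcal F$ and the inverse $(X_{\mathcal E}-\lambda I_{\mathcal E})^{-1}$ exists and is continuous from $\mathcal F$ onto $\mathcal E$. Finally let $\varrho_{\mathcal H}(A)$ be the usual resolvent set of $A$: the set of $\lambda\in\mathbb C$ such that $A-\lambda I:D(A)\to\mathcal H$ is bijective with bounded inverse. Then $$\varrho^{\mathfrak F_0}(S)=\varrho_{\mathcal H}(A).$$ Moreover, if $A$ is unbounded (equivalently, $D(A)\neq\mathcal H$), then $\varrho_{n,m}(S)=\emptyset$ for all $n,m\in\mathbb Z$ with $m\neq n-1$. -/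

import Mathlib

universe u

namespace RiggedResolvent

/-! ### Unbounded operators: powers, graph spaces -/

section Operators

variable {H : Type u} [NormedAddCommGroup H] [InnerProductSpace ℂ H]

/-- The product `g f` of two unbounded operators, on its natural domain
`{x ∈ D(f) : f x ∈ D(g)}`. -/
noncomputable def mulPMap (g f : H →ₗ.[ℂ] H) : H →ₗ.[ℂ] H :=
  g.comp (f.domRestrict ((g.domain.comap f.toFun).map f.domain.subtype)) (by
    rintro ⟨x, hx⟩
    obtain ⟨⟨y, hy, hyx⟩, hx2⟩ := hx
    change y.1 = x at hyx
    subst hyx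
    exact hy)

/-- The powers `A ^ n` of an unbounded operator on their natural domains
(`A ^ 0` is the identity of `H`). -/
noncomputable def powPMap (A : H →ₗ.[ℂ] H) : ℕ → (H →ₗ.[ℂ] H)
  | 0 => (LinearMap.id : H →ₗ[ℂ] H).toPMap ⊤
  | n + 1 => mulPMap A (powPMap A n)

theorem mem_mulPMap_graph (g f : H →ₗ.[ℂ] H) (x z : H) :
    (x, z) ∈ (mulPMap g f).graph ↔ ∃ y, (x, y) ∈ f.graph ∧ (y, z) ∈ g.graph := by
  constructor
  · intro h
    obtain ⟨⟨w, hw⟩, h1, h2⟩ := (LinearPMap.mem_graph_iff _).1 h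
    obtain ⟨⟨y, hy, hyx⟩, hx2⟩ := hw
    change y.1 = w at hyx
    subst hyx
    change y.1 = x at h1
    subst h1
    refine ⟨f y, f.mem_graph y, ?_⟩
    change mulPMap g f ⟨y.1, _⟩ = z at h2
    rw [← h2]
    exact g.mem_graph ⟨f y, hy⟩
  · rintro ⟨y, hy, hz⟩
    obtain ⟨x', hx', hxy⟩ := (LinearPMap.mem_graph_iff _).1 hy
    obtain ⟨y', hy', hyz⟩ := (LinearPMap.mem_graph_iff _).1 hz
    dsimp only at hx' hxy hy' hyz
    subst hx' hxy
    have hm : f x' ∈ g.domain := hy' ▸ y'.2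
    rw [LinearPMap.mem_graph_iff]
    refine ⟨⟨x'.1, ⟨⟨x', hm, rfl⟩, x'.2⟩⟩, rfl, ?_⟩
    have : y' = ⟨f x', hm⟩ := Subtype.ext hy'
    subst this
    exact hyz

theorem mem_powPMap_zero (A : H →ₗ.[ℂ] H) (x y : H) :
    (x, y) ∈ (powPMap A 0).graph ↔ x = y := by
  rw [LinearPMap.mem_graph_iff]
  constructor
  · rintro ⟨w, h1, h2⟩
    exact h1.symm.trans h2
  · rintro rfl
    exact ⟨⟨x, trivial⟩, rfl, rfl⟩

theorem mem_powPMap_succ (A : H →ₗ.[ℂ] H) (n : ℕ) (x z : H) :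
    (x, z) ∈ (powPMap A (n + 1)).graph ↔ ∃ y, (x, y) ∈ (powPMap A n).graph ∧ (y, z) ∈ A.graph :=
  mem_mulPMap_graph _ _ _ _

theorem mem_powPMap_one (A : H →ₗ.[ℂ] H) (x y : H) :
    (x, y) ∈ (powPMap A 1).graph ↔ (x, y) ∈ A.graph := by
  rw [mem_powPMap_succ]
  simp only [mem_powPMap_zero]
  exact ⟨fun ⟨_, h, h'⟩ => h ▸ h', fun h => ⟨x, rfl, h⟩⟩

theorem mem_powPMap_succ' (A : H →ₗ.[ℂ] H) (n : ℕ) (x z : H) :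
    (x, z) ∈ (powPMap A (n + 1)).graph ↔ ∃ y, (x, y) ∈ A.graph ∧ (y, z) ∈ (powPMap A n).graph := by
  induction n generalizing z with
  | zero =>
    rw [mem_powPMap_one]
    simp only [mem_powPMap_zero]
    exact ⟨fun h => ⟨z, h, rfl⟩, fun ⟨_, h, h'⟩ => h' ▸ h⟩
  | succ n ih =>
    rw [mem_powPMap_succ]
    constructor
    · rintro ⟨y, h1, h2⟩
      obtain ⟨w, hw, hy⟩ := (ih y).1 h1
      exact ⟨w, hw, (mem_powPMap_succ _ _ _ _).2 ⟨y, hy, h2⟩⟩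
    · rintro ⟨w, hw, h1⟩
      obtain ⟨y, hy, h2⟩ := (mem_powPMap_succ _ _ _ _).1 h1
      exact ⟨y, (ih y).2 ⟨w, hw, hy⟩, h2⟩

theorem mem_powPMap_add (A : H →ₗ.[ℂ] H) (m n : ℕ) (x z : H) :
    (x, z) ∈ (powPMap A (m + n)).graph ↔
      ∃ y, (x, y) ∈ (powPMap A n).graph ∧ (y, z) ∈ (powPMap A m).graph := by
  induction m generalizing z with
  | zero =>
    rw [Nat.zero_add]
    simp only [mem_powPMap_zero]
    exact ⟨fun h => ⟨z, h, rfl⟩, fun ⟨_, h, h'⟩ => h' ▸ h⟩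
  | succ m ih =>
    rw [Nat.add_right_comm, mem_powPMap_succ]
    constructor
    · rintro ⟨w, hw, hz⟩
      obtain ⟨y, hy, hyw⟩ := (ih w).1 hw
      exact ⟨y, hy, (mem_powPMap_succ _ _ _ _).2 ⟨w, hyw, hz⟩⟩
    · rintro ⟨y, hy, hyz⟩
      obtain ⟨w, hyw, hz⟩ := (mem_powPMap_succ _ _ _ _).1 hyz
      exact ⟨w, (ih w).2 ⟨y, hy, hyw⟩, hz⟩

/-- `A^{2n} = (Aⁿ)²`, with equality of domains. -/
theorem powPMap_two_mul (A : H →ₗ.[ℂ] H) (n : ℕ) :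
    powPMap A (2 * n) = mulPMap (powPMap A n) (powPMap A n) := by
  refine LinearPMap.eq_of_eq_graph ?_
  ext ⟨x, z⟩
  rw [two_mul, mem_powPMap_add, mem_mulPMap_graph]

theorem graph_unique {T : H →ₗ.[ℂ] H} {x y z : H} (h : (x, y) ∈ T.graph) (h' : (x, z) ∈ T.graph) :
    y = z := by
  obtain ⟨a, ha, ha'⟩ := (LinearPMap.mem_graph_iff _).1 h
  obtain ⟨b, hb, hb'⟩ := (LinearPMap.mem_graph_iff _).1 h'
  dsimp only at *
  have : a = b := Subtype.ext (ha.trans hb.symm)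
  rw [← ha', ← hb', this]

theorem mem_domain_of_graph {T : H →ₗ.[ℂ] H} {x y : H} (h : (x, y) ∈ T.graph) : x ∈ T.domain := by
  obtain ⟨a, ha, -⟩ := (LinearPMap.mem_graph_iff _).1 h
  change a.1 = x at ha
  exact ha ▸ a.2

theorem graph_apply {T : H →ₗ.[ℂ] H} {x y : H} (h : (x, y) ∈ T.graph) (hx : x ∈ T.domain) :
    T ⟨x, hx⟩ = y := graph_unique (T.mem_graph ⟨x, hx⟩) h

variable [CompleteSpace H] {T : H →ₗ.[ℂ] H}

/-- The graph of `T`, as a subspace of the Hilbert space direct sum `H ⊕ H`. -/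
def graphSubmodule (T : H →ₗ.[ℂ] H) : Submodule ℂ (WithLp 2 (H × H)) :=
  T.graph.comap (WithLp.linearEquiv 2 ℂ (H × H)).toLinearMap

/-- For a self-adjoint operator `T`, the Hilbert space obtained by endowing the domain `D(T)` with
the graph norm `(‖x‖² + ‖T x‖²)^{1/2}`. The vector `x ∈ D(T)` is represented by the point `(x, T x)`
of the graph of `T` in the Hilbert space direct sum `H ⊕ H`. -/
abbrev GraphSpace (_hT : IsSelfAdjoint T) : Type u := graphSubmodule T

/-- The continuous inclusion `D(T) → H`. -/
noncomputable def GraphSpace.incl (hT : IsSelfAdjoint T) : GraphSpace hT →L[ℂ] H :=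
  WithLp.fstL 2 ℂ H H ∘L (graphSubmodule T).subtypeL

/-- The operator `T`, bounded from `D(T)` to `H`. -/
noncomputable def GraphSpace.op (hT : IsSelfAdjoint T) : GraphSpace hT →L[ℂ] H :=
  WithLp.sndL 2 ℂ H H ∘L (graphSubmodule T).subtypeL

theorem GraphSpace.graph (hT : IsSelfAdjoint T) (x : GraphSpace hT) :
    (GraphSpace.incl hT x, GraphSpace.op hT x) ∈ T.graph := x.2

theorem GraphSpace.inner_eq (hT : IsSelfAdjoint T) (x y : GraphSpace hT) :
    (inner ℂ x y : ℂ) = inner ℂ (GraphSpace.incl hT x) (GraphSpace.incl hT y) +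
      inner ℂ (GraphSpace.op hT x) (GraphSpace.op hT y) := WithLp.prod_inner_apply _ _

theorem GraphSpace.norm_sq' (hT : IsSelfAdjoint T) (x : GraphSpace hT) :
    ‖x‖ ^ 2 = ‖GraphSpace.incl hT x‖ ^ 2 + ‖GraphSpace.op hT x‖ ^ 2 :=
  WithLp.prod_norm_sq_eq_of_L2 _

theorem GraphSpace.norm_le (hT : IsSelfAdjoint T) (x : GraphSpace hT) :
    ‖x‖ ≤ ‖GraphSpace.incl hT x‖ + ‖GraphSpace.op hT x‖ := by
  refine abs_le_of_sq_le_sq' ?_ (by positivity) |>.2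
  rw [GraphSpace.norm_sq']
  nlinarith [norm_nonneg (GraphSpace.incl hT x), norm_nonneg (GraphSpace.op hT x)]

theorem GraphSpace.incl_injective (hT : IsSelfAdjoint T) :
    Function.Injective (GraphSpace.incl hT) := by
  intro x y h
  have hx := GraphSpace.graph hT x
  rw [h] at hx
  have h2 := graph_unique hx (GraphSpace.graph hT y)
  exact Subtype.ext (WithLp.ofLp_injective 2 (Prod.ext h h2))

/-- The element of `GraphSpace` given by a point of the graph. -/
noncomputable def GraphSpace.mk (hT : IsSelfAdjoint T) (x : T.domain) : GraphSpace hT :=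
  ⟨WithLp.toLp 2 ((x : H), T x), T.mem_graph x⟩

theorem GraphSpace.exists_of_graph (hT : IsSelfAdjoint T) {x y : H} (h : (x, y) ∈ T.graph) :
    ∃ w : GraphSpace hT, GraphSpace.incl hT w = x ∧ GraphSpace.op hT w = y :=
  ⟨⟨WithLp.toLp 2 (x, y), h⟩, rfl, rfl⟩

instance (hT : IsSelfAdjoint T) : CompleteSpace (GraphSpace hT) := by
  refine Metric.complete_of_cauchySeq_tendsto fun u hu => ?_
  have h1 := (GraphSpace.incl hT).uniformContinuous.comp_cauchySeq hu
  have h2 := (GraphSpace.op hT).uniformContinuous.comp_cauchySeq hu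
  obtain ⟨x, hx⟩ := cauchySeq_tendsto_of_complete h1
  obtain ⟨y, hy⟩ := cauchySeq_tendsto_of_complete h2
  have hc : IsClosed (T.graph : Set (H × H)) := hT.isClosed
  have hxy : (x, y) ∈ T.graph := hc.mem_of_tendsto (hx.prodMk_nhds hy)
    (Filter.Eventually.of_forall fun n => GraphSpace.graph hT (u n))
  obtain ⟨w, hw, hw'⟩ := GraphSpace.exists_of_graph hT hxy
  refine ⟨w, tendsto_iff_norm_sub_tendsto_zero.2 ?_⟩
  have h3 : Filter.Tendsto (fun n => ‖GraphSpace.incl hT (u n) - x‖ + ‖GraphSpace.op hT (u n) - y‖)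
      Filter.atTop (nhds 0) := by
    simpa using (tendsto_iff_norm_sub_tendsto_zero.1 hx).add (tendsto_iff_norm_sub_tendsto_zero.1 hy)
  refine squeeze_zero (fun _ => norm_nonneg _) (fun n => ?_) h3
  refine (GraphSpace.norm_le hT _).trans (le_of_eq ?_)
  rw [map_sub, map_sub, hw, hw']

theorem graph_adjoint (hT : IsSelfAdjoint T) {x y : H}
    (h : ∀ a b, (a, b) ∈ T.graph → (inner ℂ y a : ℂ) = inner ℂ x b) : (x, y) ∈ T.graph := by
  have hd := hT.dense_domain
  have hx : x ∈ T.adjoint.domain :=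
    T.mem_adjoint_domain_of_exists x ⟨y, fun a => h a (T a) (T.mem_graph a)⟩
  have hy : T.adjoint ⟨x, hx⟩ = y :=
    LinearPMap.adjoint_apply_eq hd ⟨x, hx⟩ fun a => h a (T a) (T.mem_graph a)
  have := T.adjoint.mem_graph ⟨x, hx⟩
  rw [hy] at this
  change (x, y) ∈ T.adjoint.graph at this
  rwa [LinearPMap.isSelfAdjoint_def.1 hT] at this

theorem graph_symm (hT : IsSelfAdjoint T) {x y a b : H} (h : (x, y) ∈ T.graph)
    (h' : (a, b) ∈ T.graph) : (inner ℂ y a : ℂ) = inner ℂ x b := by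
  have hd := hT.dense_domain
  have hf := LinearPMap.adjoint_isFormalAdjoint hd
  rw [LinearPMap.isSelfAdjoint_def.1 hT] at hf
  obtain ⟨p, hp, hp'⟩ := (LinearPMap.mem_graph_iff _).1 h
  obtain ⟨q, hq, hq'⟩ := (LinearPMap.mem_graph_iff _).1 h'
  dsimp only at *
  rw [← hp', ← hq', ← hp, ← hq]
  exact hf p q

/-- The bounded operator `(I + T²)⁻¹` of a self-adjoint operator `T`, obtained as `J J*` from the
inclusion `J : D(T) → H`; see `invOneAddSq_spec` and `invOneAddSq_unique`. -/
noncomputable def invOneAddSq (hT : IsSelfAdjoint T) : H →L[ℂ] H :=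
  GraphSpace.incl hT ∘L ContinuousLinearMap.adjoint (GraphSpace.incl hT)

/-- `T (I + T²)⁻¹`. -/
noncomputable def opInvOneAddSq (hT : IsSelfAdjoint T) : H →L[ℂ] H :=
  GraphSpace.op hT ∘L ContinuousLinearMap.adjoint (GraphSpace.incl hT)

theorem graph_invOneAddSq (hT : IsSelfAdjoint T) (x : H) :
    (invOneAddSq hT x, opInvOneAddSq hT x) ∈ T.graph := GraphSpace.graph hT _

/-- `(I + T²) ((I + T²)⁻¹ x) = x`, including the fact that `(I + T²)⁻¹ x ∈ D(T²)`. -/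
theorem invOneAddSq_spec (hT : IsSelfAdjoint T) (x : H) :
    (invOneAddSq hT x, x - invOneAddSq hT x) ∈ (mulPMap T T).graph := by
  refine (mem_mulPMap_graph _ _ _ _).2 ⟨_, graph_invOneAddSq hT x, graph_adjoint hT ?_⟩
  intro a b hab
  obtain ⟨w, rfl, rfl⟩ := GraphSpace.exists_of_graph hT hab
  have := ContinuousLinearMap.adjoint_inner_left (GraphSpace.incl hT) w x
  rw [GraphSpace.inner_eq] at this
  rw [inner_sub_left, sub_eq_iff_eq_add, add_comm]
  exact this.symm

theorem invOneAddSq_unique (hT : IsSelfAdjoint T) {x y : H} (h : (x, y) ∈ (mulPMap T T).graph) :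
    invOneAddSq hT (x + y) = x := by
  obtain ⟨z, hz, hz'⟩ := (mem_mulPMap_graph _ _ _ _).1 (invOneAddSq_spec hT (x + y))
  obtain ⟨w, hw, hw'⟩ := (mem_mulPMap_graph _ _ _ _).1 h
  set v := invOneAddSq hT (x + y)
  have h1 : (v - x, z - w) ∈ T.graph := T.graph.sub_mem hz hw
  have h2 : (z - w, -(v - x)) ∈ T.graph := by
    have := T.graph.sub_mem hz' hw'
    convert this using 1
    · rw [Prod.mk_sub_mk]
      congr 1
      abel
  have h3 := graph_symm hT h1 h2
  rw [inner_neg_right] at h3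
  have h4 := congrArg Complex.re h3
  have h5 : (inner ℂ (z - w) (z - w) : ℂ).re = ‖z - w‖ ^ 2 := inner_self_eq_norm_sq (𝕜 := ℂ) _
  have h6 : (inner ℂ (v - x) (v - x) : ℂ).re = ‖v - x‖ ^ 2 := inner_self_eq_norm_sq (𝕜 := ℂ) _
  rw [Complex.neg_re, h5, h6] at h4
  have : ‖v - x‖ ^ 2 = 0 := by nlinarith [sq_nonneg ‖z - w‖, sq_nonneg ‖v - x‖]
  rwa [sq_eq_zero_iff, norm_eq_zero, sub_eq_zero] at this

theorem invOneAddSq_nonneg (hT : IsSelfAdjoint T) : 0 ≤ invOneAddSq hT := by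
  rw [ContinuousLinearMap.nonneg_iff_isPositive]
  exact ContinuousLinearMap.isPositive_self_comp_adjoint (GraphSpace.incl hT)

/-- The bounded operator `(I + T²)^{-1/2}`: the positive square root of `(I + T²)⁻¹`. -/
noncomputable def invSqrtOneAddSq (hT : IsSelfAdjoint T) : H →L[ℂ] H := CFC.sqrt (invOneAddSq hT)

theorem norm_invSqrtOneAddSq (hT : IsSelfAdjoint T) (x : H) :
    ‖invSqrtOneAddSq hT x‖ = ‖ContinuousLinearMap.adjoint (GraphSpace.incl hT) x‖ := by
  have h0 : invSqrtOneAddSq hT * invSqrtOneAddSq hT = invOneAddSq hT :=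
    CFC.sqrt_mul_sqrt_self _ (invOneAddSq_nonneg hT)
  have h1 : IsSelfAdjoint (invSqrtOneAddSq hT) := (CFC.sqrt_nonneg (invOneAddSq hT)).isSelfAdjoint
  have h2 : (inner ℂ (invSqrtOneAddSq hT x) (invSqrtOneAddSq hT x) : ℂ) =
      inner ℂ (ContinuousLinearMap.adjoint (GraphSpace.incl hT) x)
        (ContinuousLinearMap.adjoint (GraphSpace.incl hT) x) := by
    rw [ContinuousLinearMap.adjoint_inner_left]
    have := ContinuousLinearMap.adjoint_inner_right (invSqrtOneAddSq hT) x (invSqrtOneAddSq hT x)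
    rw [ContinuousLinearMap.isSelfAdjoint_iff'.1 h1] at this
    rw [← this]
    change inner ℂ x ((invSqrtOneAddSq hT * invSqrtOneAddSq hT) x) = _
    rw [h0]
    rfl
  have h3 := congrArg Complex.re h2
  have h5 := inner_self_eq_norm_sq (𝕜 := ℂ) (invSqrtOneAddSq hT x)
  have h6 := inner_self_eq_norm_sq (𝕜 := ℂ) (ContinuousLinearMap.adjoint (GraphSpace.incl hT) x)
  refine (sq_eq_sq₀ (norm_nonneg _) (norm_nonneg _)).1 ?_
  rw [← h5, ← h6]
  exact h3

end Operators

/-! ### Powers of a self-adjoint operator are self-adjoint -/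

section Powers

variable {H : Type u} [NormedAddCommGroup H] [InnerProductSpace ℂ H] [CompleteSpace H]
  {A : H →ₗ.[ℂ] H}

theorem pow_symm (hA : IsSelfAdjoint A) (n : ℕ) {x y a b : H} (h : (x, y) ∈ (powPMap A n).graph)
    (h' : (a, b) ∈ (powPMap A n).graph) : (inner ℂ y a : ℂ) = inner ℂ x b := by
  induction n generalizing y a with
  | zero =>
    rw [mem_powPMap_zero] at h h'
    rw [h, h']
  | succ n ih =>
    obtain ⟨w, hw, hy⟩ := (mem_powPMap_succ _ _ _ _).1 h
    obtain ⟨c, hc, hb⟩ := (mem_powPMap_succ' _ _ _ _).1 h'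
    rw [graph_symm hA hy hc]
    exact ih hw hb

theorem invOneAddSq_graph (hA : IsSelfAdjoint A) {x y : H} (h : (x, y) ∈ A.graph) :
    (invOneAddSq hA x, invOneAddSq hA y) ∈ A.graph ∧ opInvOneAddSq hA x = invOneAddSq hA y := by
  obtain ⟨v, hv, hv'⟩ := (mem_mulPMap_graph _ _ _ _).1 (invOneAddSq_spec hA x)
  have h1 : v = opInvOneAddSq hA x := graph_unique hv (graph_invOneAddSq hA x)
  obtain ⟨w, hw, -⟩ := (mem_mulPMap_graph _ _ _ _).1 (invOneAddSq_spec hA (invOneAddSq hA x))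
  obtain ⟨c, hc⟩ : ∃ c, (invOneAddSq hA x, c) ∈ A.graph := ⟨v, hv⟩
  have h2 : (x - invOneAddSq hA x, y - v) ∈ A.graph := A.graph.sub_mem h hv
  have h3 := invOneAddSq_unique hA ((mem_mulPMap_graph _ _ _ _).2 ⟨_, hv', h2⟩)
  rw [add_sub_cancel] at h3
  rw [h3]
  exact ⟨hv, h1.symm⟩

theorem opInvOneAddSq_commute (hA : IsSelfAdjoint A) :
    Commute (invOneAddSq hA) (opInvOneAddSq hA) := by
  ext x
  exact (invOneAddSq_graph hA (graph_invOneAddSq hA x)).2.symm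

/-- Bounded functions of `(I + A²)⁻¹` that vanish at `0` commute with `A`. -/
theorem cfc_graph (hA : IsSelfAdjoint A) (f : ℝ → ℝ) {x y : H} (h : (x, y) ∈ A.graph) :
    ((invOneAddSq hA * cfc f (invOneAddSq hA)) x, (invOneAddSq hA * cfc f (invOneAddSq hA)) y)
      ∈ A.graph := by
  have hc := (opInvOneAddSq_commute hA).cfc_real f
  have hc' := (Commute.refl (invOneAddSq hA)).cfc_real f
  have h1 := graph_invOneAddSq hA (cfc f (invOneAddSq hA) x)
  have h2 : opInvOneAddSq hA (cfc f (invOneAddSq hA) x) =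
      (invOneAddSq hA * cfc f (invOneAddSq hA)) y := by
    change (opInvOneAddSq hA * cfc f (invOneAddSq hA)) x = _
    rw [← hc.eq, ← hc'.eq]
    change cfc f (invOneAddSq hA) (opInvOneAddSq hA x) = _
    rw [(invOneAddSq_graph hA h).2]
    rfl
  rw [h2] at h1
  exact h1

/-- A continuous cut-off function which vanishes near `0`. -/
noncomputable def cutoff (k : ℕ) (t : ℝ) : ℝ := min 1 (max 0 (k * |t| - 1))

/-- The smoothing operators: a spectral cut-off of `A`. -/
noncomputable def smoothing (hA : IsSelfAdjoint A) (k : ℕ) : H →L[ℂ] H :=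
  cfc (cutoff k) (invOneAddSq hA)

theorem cutoff_div_continuous (k m : ℕ) : Continuous fun t : ℝ => cutoff k t / t ^ m := by
  rw [continuous_iff_continuousAt]
  intro t
  by_cases ht : t = 0
  · subst ht
    have : (fun t : ℝ => cutoff k t / t ^ m) =ᶠ[nhds 0] fun _ => 0 := by
      have h : ∀ᶠ t : ℝ in nhds 0, (k : ℝ) * |t| < 1 := by
        have hc : Continuous fun t : ℝ => (k : ℝ) * |t| := by fun_prop
        exact hc.continuousAt.eventually_lt continuousAt_const (by simp)
      filter_upwards [h] with t ht
      have : max 0 ((k : ℝ) * |t| - 1) = 0 := max_eq_left (by linarith)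
      simp [cutoff, this]
    exact continuousAt_const.congr this.symm
  · refine ContinuousAt.div ?_ (by fun_prop) (pow_ne_zero _ ht)
    have : Continuous (cutoff k) := by unfold cutoff; fun_prop
    exact this.continuousAt

theorem smoothing_eq (hA : IsSelfAdjoint A) (k m : ℕ) :
    smoothing hA k = invOneAddSq hA ^ m * cfc (fun t => cutoff k t / t ^ m) (invOneAddSq hA) := by
  have hs : IsSelfAdjoint (invOneAddSq hA) := (invOneAddSq_nonneg hA).isSelfAdjoint
  rw [← cfc_pow_id (R := ℝ) (invOneAddSq hA) m hs, ← cfc_mul _ _ _ (by fun_prop)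
    (cutoff_div_continuous k m).continuousOn]
  refine cfc_congr fun t _ => ?_
  by_cases ht : t = 0
  · subst ht
    simp [cutoff]
  · field_simp

theorem smoothing_graph (hA : IsSelfAdjoint A) (k n : ℕ) {x y : H}
    (h : (x, y) ∈ (powPMap A n).graph) :
    (smoothing hA k x, smoothing hA k y) ∈ (powPMap A n).graph := by
  induction n generalizing y with
  | zero =>
    rw [mem_powPMap_zero] at h ⊢
    rw [h]
  | succ n ih =>
    obtain ⟨w, hw, hy⟩ := (mem_powPMap_succ _ _ _ _).1 h
    refine (mem_powPMap_succ _ _ _ _).2 ⟨_, ih hw, ?_⟩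
    rw [smoothing_eq hA k 1, pow_one]
    exact cfc_graph hA _ hy

theorem invOneAddSq_pow_graph (hA : IsSelfAdjoint A) (n : ℕ) {x y : H}
    (h : (x, y) ∈ (powPMap A n).graph) :
    (invOneAddSq hA x, invOneAddSq hA y) ∈ (powPMap A n).graph := by
  induction n generalizing y with
  | zero =>
    rw [mem_powPMap_zero] at h ⊢
    rw [h]
  | succ n ih =>
    obtain ⟨w, hw, hy⟩ := (mem_powPMap_succ _ _ _ _).1 h
    exact (mem_powPMap_succ _ _ _ _).2 ⟨_, ih hw, (invOneAddSq_graph hA hy).1⟩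

theorem invOneAddSq_pow_mem (hA : IsSelfAdjoint A) (n : ℕ) (x : H) :
    ∃ y, ((invOneAddSq hA ^ n) x, y) ∈ (powPMap A n).graph := by
  induction n with
  | zero => exact ⟨x, (mem_powPMap_zero _ _ _).2 rfl⟩
  | succ n ih =>
    obtain ⟨y, hy⟩ := ih
    rw [pow_succ']
    exact ⟨_, (mem_powPMap_succ _ _ _ _).2 ⟨_, invOneAddSq_pow_graph hA n hy,
      graph_invOneAddSq hA y⟩⟩

theorem smoothing_mem (hA : IsSelfAdjoint A) (k n : ℕ) (x : H) :
    smoothing hA k x ∈ (powPMap A n).domain := by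
  rw [smoothing_eq hA k n]
  obtain ⟨y, hy⟩ := invOneAddSq_pow_mem hA n (cfc (fun t => cutoff k t / t ^ n) (invOneAddSq hA) x)
  exact mem_domain_of_graph hy

theorem smoothing_isSelfAdjoint (hA : IsSelfAdjoint A) (k : ℕ) :
    IsSelfAdjoint (smoothing hA k) := cfc_predicate _ _

theorem cutoff_abs_le (k : ℕ) (t : ℝ) : |cutoff k t| ≤ 1 := by
  have h : 0 ≤ cutoff k t := le_min zero_le_one (le_max_left _ _)
  rw [abs_of_nonneg h]
  exact min_le_left _ _

theorem norm_smoothing_le (hA : IsSelfAdjoint A) (k : ℕ) : ‖smoothing hA k‖ ≤ 1 :=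
  norm_cfc_le zero_le_one fun t _ => cutoff_abs_le k t

theorem norm_smoothing_sub_le (hA : IsSelfAdjoint A) (k : ℕ) :
    ‖smoothing hA (k + 1) * invOneAddSq hA - invOneAddSq hA‖ ≤ 2 / (k + 1) := by
  have hs : IsSelfAdjoint (invOneAddSq hA) := (invOneAddSq_nonneg hA).isSelfAdjoint
  have hc : Continuous (cutoff (k + 1)) := by unfold cutoff; fun_prop
  have h : smoothing hA (k + 1) * invOneAddSq hA - invOneAddSq hA =
      cfc (fun t : ℝ => cutoff (k + 1) t * t - t) (invOneAddSq hA) := by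
    rw [cfc_sub (fun t : ℝ => cutoff (k + 1) t * t) (fun t => t) _ (by fun_prop) (by fun_prop),
      cfc_mul (cutoff (k + 1)) (fun t => t) _ (by fun_prop) (by fun_prop), cfc_id' ℝ _ hs]
    rfl
  rw [h]
  refine norm_cfc_le (by positivity) fun t _ => ?_
  have hk : (0 : ℝ) < k + 1 := by positivity
  by_cases ht : 2 ≤ ((k : ℝ) + 1) * |t|
  · have : cutoff (k + 1) t = 1 := by
      refine min_eq_left (le_max_of_le_right ?_)
      push_cast
      linarith
    rw [this]
    simp only [one_mul, sub_self, norm_zero]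
    positivity
  · have h0 : 0 ≤ cutoff (k + 1) t := le_min zero_le_one (le_max_left _ _)
    have h1 : cutoff (k + 1) t ≤ 1 := min_le_left _ _
    have : cutoff (k + 1) t * t - t = -((1 - cutoff (k + 1) t) * t) := by ring
    rw [this, norm_neg, norm_mul, Real.norm_eq_abs, Real.norm_eq_abs, abs_of_nonneg (by linarith),
      le_div_iff₀ hk]
    nlinarith [abs_nonneg t, mul_nonneg h0 (mul_nonneg (abs_nonneg t) hk.le)]

theorem dense_range_invOneAddSq (hA : IsSelfAdjoint A) : DenseRange (invOneAddSq hA) := by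
  have hs : IsSelfAdjoint (invOneAddSq hA) := (invOneAddSq_nonneg hA).isSelfAdjoint
  have h : (LinearMap.range (invOneAddSq hA).toLinearMap).topologicalClosure = ⊤ := by
    rw [Submodule.topologicalClosure_eq_top_iff, Submodule.eq_bot_iff]
    intro x hx
    have h1 : invOneAddSq hA x = 0 := by
      refine ext_inner_left ℂ fun y => ?_
      rw [inner_zero_right]
      have h2 := ContinuousLinearMap.adjoint_inner_left (invOneAddSq hA) x y
      rw [ContinuousLinearMap.isSelfAdjoint_iff'.1 hs] at h2
      rw [← h2]
      exact (Submodule.mem_orthogonal _ _).1 hx _ ⟨y, rfl⟩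
    have h2 := invOneAddSq_spec hA x
    rw [h1, sub_zero] at h2
    exact graph_unique h2 ((mulPMap A A).graph.zero_mem)
  have := (Submodule.dense_iff_topologicalClosure_eq_top).2 h
  exact this

theorem smoothing_tendsto (hA : IsSelfAdjoint A) (x : H) :
    Filter.Tendsto (fun k => smoothing hA (k + 1) x) Filter.atTop (nhds x) := by
  rw [Metric.tendsto_atTop]
  intro ε hε
  obtain ⟨z, hz⟩ := (dense_range_invOneAddSq hA).exists_dist_lt x (show 0 < ε / 3 by positivity)
  obtain ⟨N, hN⟩ := exists_nat_gt (2 * ‖z‖ / (ε / 3))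
  refine ⟨N, fun k hk => ?_⟩
  have h1 : ‖smoothing hA (k + 1) (x - invOneAddSq hA z)‖ ≤ ‖x - invOneAddSq hA z‖ := by
    simpa using (smoothing hA (k + 1)).le_of_opNorm_le (norm_smoothing_le hA _)
      (x - invOneAddSq hA z)
  have h2 : ‖smoothing hA (k + 1) (invOneAddSq hA z) - invOneAddSq hA z‖ ≤ 2 / (k + 1) * ‖z‖ :=
    (smoothing hA (k + 1) * invOneAddSq hA - invOneAddSq hA).le_of_opNorm_le
      (norm_smoothing_sub_le hA k) z
  have h3 : 2 / ((k : ℝ) + 1) * ‖z‖ < ε / 3 := by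
    have hk' : (N : ℝ) ≤ k := by exact_mod_cast hk
    rw [div_lt_iff₀ (by positivity)] at hN
    rw [div_mul_eq_mul_div, div_lt_iff₀ (by positivity)]
    nlinarith
  rw [dist_eq_norm] at hz ⊢
  have h4 : smoothing hA (k + 1) x - x = smoothing hA (k + 1) (x - invOneAddSq hA z) +
      (smoothing hA (k + 1) (invOneAddSq hA z) - invOneAddSq hA z) - (x - invOneAddSq hA z) := by
    rw [map_sub]
    abel
  rw [h4]
  have h5 := norm_sub_le (smoothing hA (k + 1) (x - invOneAddSq hA z) +
      (smoothing hA (k + 1) (invOneAddSq hA z) - invOneAddSq hA z)) (x - invOneAddSq hA z)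
  have h6 := norm_add_le (smoothing hA (k + 1) (x - invOneAddSq hA z))
      (smoothing hA (k + 1) (invOneAddSq hA z) - invOneAddSq hA z)
  linarith

/-- `‖A x‖² ≤ ‖x‖ ‖A² x‖` gives that intermediate powers are controlled by the extreme ones. -/
theorem norm_pow_le (hA : IsSelfAdjoint A) (n : ℕ) {x y z : H}
    (hy : (x, y) ∈ (powPMap A n).graph) (hz : (y, z) ∈ A.graph) : ‖y‖ ≤ max ‖x‖ ‖z‖ := by
  induction n generalizing y z with
  | zero =>
    rw [mem_powPMap_zero] at hy
    rw [hy]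
    exact le_max_left _ _
  | succ n ih =>
    obtain ⟨w, hw, hwy⟩ := (mem_powPMap_succ _ _ _ _).1 hy
    have h1 := ih hw hwy
    have h2 : ‖y‖ ^ 2 ≤ ‖w‖ * ‖z‖ := by
      rw [← inner_self_eq_norm_sq (𝕜 := ℂ) y, graph_symm hA hwy hz]
      exact (Complex.re_le_norm _).trans (norm_inner_le_norm _ _)
    rcases le_max_iff.1 h1 with h3 | h3
    · rcases le_or_gt ‖y‖ ‖x‖ with h4 | h4
      · exact le_max_of_le_left h4
      · refine le_max_of_le_right ?_
        nlinarith [norm_nonneg x, norm_nonneg z, norm_nonneg w, norm_nonneg y]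
    · rcases eq_or_lt_of_le (norm_nonneg y) with h4 | h4
      · rw [← h4]
        exact le_max_of_le_right (norm_nonneg z)
      · refine le_max_of_le_right ?_
        nlinarith [norm_nonneg z]

theorem pow_isClosed (hA : IsSelfAdjoint A) (n : ℕ) :
    IsClosed ((powPMap A n).graph : Set (H × H)) := by
  induction n with
  | zero =>
    have : ((powPMap A 0).graph : Set (H × H)) = {p | p.1 = p.2} := by
      ext ⟨x, y⟩
      exact mem_powPMap_zero A x y
    rw [this]
    exact isClosed_eq continuous_fst continuous_snd
  | succ n ih =>
    rw [← isSeqClosed_iff_isClosed]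
    rintro u ⟨x, y⟩ hu hlim
    have hx : Filter.Tendsto (fun k => (u k).1) Filter.atTop (nhds x) :=
      (continuous_fst.tendsto _).comp hlim
    have hy : Filter.Tendsto (fun k => (u k).2) Filter.atTop (nhds y) :=
      (continuous_snd.tendsto _).comp hlim
    choose w hw hwy using fun k => (mem_powPMap_succ A n (u k).1 (u k).2).1 (hu k)
    have hcx := Metric.cauchySeq_iff.1 hx.cauchySeq
    have hcy := Metric.cauchySeq_iff.1 hy.cauchySeq
    have hcw : CauchySeq w := by
      refine Metric.cauchySeq_iff.2 fun ε hε => ?_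
      obtain ⟨N, hN⟩ := hcx ε hε
      obtain ⟨M, hM⟩ := hcy ε hε
      refine ⟨max N M, fun i hi j hj => ?_⟩
      have h := norm_pow_le hA n ((powPMap A n).graph.sub_mem (hw i) (hw j))
        (A.graph.sub_mem (hwy i) (hwy j))
      rw [dist_eq_norm]
      refine h.trans_lt (max_lt ?_ ?_)
      · rw [← dist_eq_norm]
        exact hN i (le_of_max_le_left hi) j (le_of_max_le_left hj)
      · rw [← dist_eq_norm]
        exact hM i (le_of_max_le_right hi) j (le_of_max_le_right hj)
    obtain ⟨v, hv⟩ := cauchySeq_tendsto_of_complete hcw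
    have h1 : (x, v) ∈ (powPMap A n).graph :=
      ih.mem_of_tendsto (hx.prodMk_nhds hv) (Filter.Eventually.of_forall hw)
    have hcA : IsClosed (A.graph : Set (H × H)) := hA.isClosed
    have h2 : (v, y) ∈ A.graph :=
      hcA.mem_of_tendsto (hv.prodMk_nhds hy) (Filter.Eventually.of_forall hwy)
    exact (mem_powPMap_succ _ _ _ _).2 ⟨v, h1, h2⟩

theorem pow_isSelfAdjoint (hA : IsSelfAdjoint A) (n : ℕ) : IsSelfAdjoint (powPMap A n) := by
  have hd : Dense ((powPMap A n).domain : Set H) := fun x =>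
    mem_closure_of_tendsto (smoothing_tendsto hA x)
      (Filter.Eventually.of_forall fun k => smoothing_mem hA (k + 1) n x)
  rw [LinearPMap.isSelfAdjoint_def]
  refine le_antisymm (LinearPMap.le_of_le_graph ?_) (LinearPMap.le_of_le_graph ?_)
  · rintro ⟨y, z⟩ hyz
    have hyz' : ∀ a b, (a, b) ∈ (powPMap A n).graph → (inner ℂ z a : ℂ) = inner ℂ y b := by
      intro a b hab
      obtain ⟨p, hp, hp'⟩ := (LinearPMap.mem_graph_iff _).1 hyz
      obtain ⟨q, hq, hq'⟩ := (LinearPMap.mem_graph_iff _).1 hab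
      dsimp only at *
      rw [← hp', ← hq', ← hp, ← hq]
      exact LinearPMap.adjoint_isFormalAdjoint hd p q
    refine (pow_isClosed hA n).mem_of_tendsto
      ((smoothing_tendsto hA y).prodMk_nhds (smoothing_tendsto hA z))
      (Filter.Eventually.of_forall fun k => ?_)
    have h1 := (powPMap A n).mem_graph ⟨_, smoothing_mem hA (k + 1) n y⟩
    have hs := ContinuousLinearMap.isSelfAdjoint_iff'.1 (smoothing_isSelfAdjoint hA (k + 1))
    have h2 : powPMap A n ⟨_, smoothing_mem hA (k + 1) n y⟩ = smoothing hA (k + 1) z := by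
      refine hd.eq_of_inner_left ℂ fun a ha => ?_
      have h3 := (powPMap A n).mem_graph ⟨a, ha⟩
      rw [pow_symm hA n h1 h3]
      have h4 := smoothing_graph hA (k + 1) n h3
      have h5 := hyz' _ _ h4
      have h6 := ContinuousLinearMap.adjoint_inner_left (smoothing hA (k + 1))
        (powPMap A n ⟨a, ha⟩) y
      have h7 := ContinuousLinearMap.adjoint_inner_left (smoothing hA (k + 1)) a z
      rw [hs] at h6 h7
      rw [h6, h7, h5]
    rw [h2] at h1
    exact h1
  · rintro ⟨x, y⟩ hxy
    obtain ⟨p, hp, hp'⟩ := (LinearPMap.mem_graph_iff _).1 hxy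
    dsimp only at hp hp'
    have h : ∀ q : (powPMap A n).domain, (inner ℂ y (q : H) : ℂ) = inner ℂ x (powPMap A n q) :=
      fun q => pow_symm hA n hxy ((powPMap A n).mem_graph q)
    have hx : x ∈ (powPMap A n).adjoint.domain :=
      (powPMap A n).mem_adjoint_domain_of_exists x ⟨y, h⟩
    have h2 := (powPMap A n).adjoint.mem_graph ⟨x, hx⟩
    rw [LinearPMap.adjoint_apply_eq hd ⟨x, hx⟩ h] at h2
    exact h2

end Powers

/-! ### Rigged Hilbert spaces, interspaces and resolvent sets -/

/-- A rigged Hilbert space `D[t] ⊂ H ⊂ D^×[t^×]`, given by a locally convex space `D[t]` that is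
continuously, injectively and densely embedded in the Hilbert space `H`. -/
structure RiggedSpace (H : Type u) [NormedAddCommGroup H] [InnerProductSpace ℂ H] where
  D : Type u
  [addCommGroup : AddCommGroup D]
  [module : Module ℂ D]
  [topology : TopologicalSpace D]
  [isTopologicalAddGroup : IsTopologicalAddGroup D]
  [continuousSMul : ContinuousSMul ℂ D]
  [locallyConvex : PolynormableSpace ℂ D]
  incl : D →L[ℂ] H
  incl_injective : Function.Injective incl
  incl_dense : DenseRange incl

attribute [instance] RiggedSpace.addCommGroup RiggedSpace.module RiggedSpace.topology
  RiggedSpace.isTopologicalAddGroup RiggedSpace.continuousSMul RiggedSpace.locallyConvex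

/-- The conjugate dual `D^×` of a topological vector space: the continuous conjugate linear
functionals with the topology of uniform convergence on bounded sets (the strong topology). -/
abbrev ConjDual (D : Type u) [AddCommGroup D] [Module ℂ D] [TopologicalSpace D] : Type u :=
  D →L⋆[ℂ] ℂ

/-- For continuous linear `i : D → H`, the map `H → D^×`, `ξ ↦ (η ↦ ⟨ξ, i η⟩)`. Here `⟨·, ·⟩` is
linear in the first variable, so it is Mathlib's `inner` with the arguments interchanged. -/
noncomputable def toConjDual {H D : Type u} [NormedAddCommGroup H] [InnerProductSpace ℂ H]
    [AddCommGroup D] [Module ℂ D] [TopologicalSpace D] [IsTopologicalAddGroup D]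
    [ContinuousSMul ℂ D] (i : D →L[ℂ] H) : H →L[ℂ] ConjDual D :=
  (ContinuousLinearMap.precomp ℂ i) ∘L (innerSL ℂ (E := H)).flip

theorem toConjDual_apply {H D : Type u} [NormedAddCommGroup H] [InnerProductSpace ℂ H]
    [AddCommGroup D] [Module ℂ D] [TopologicalSpace D] [IsTopologicalAddGroup D]
    [ContinuousSMul ℂ D] (i : D →L[ℂ] H) (ξ : H) (η : D) :
    toConjDual i ξ η = inner ℂ (i η) ξ := rfl

theorem continuous_norm_conjDual {E : Type u} [NormedAddCommGroup E] [InnerProductSpace ℂ E] :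
    Continuous fun f : ConjDual E => ‖f‖ := continuous_norm

section General

variable {H : Type u} [NormedAddCommGroup H] [InnerProductSpace ℂ H]

/-- The embedding `H ⊂ D^×` of a rigged Hilbert space. -/
noncomputable def RiggedSpace.embed (R : RiggedSpace H) : H →L[ℂ] ConjDual R.D :=
  toConjDual R.incl

/-- A Hilbert space `E` which is an interspace of the rigged Hilbert space: `D ⊂ E ⊂ D^×`, where
both inclusions are continuous, `D` is dense in `E`, and the composed inclusion `D ⊂ D^×` is the one
of the rigged Hilbert space. (The Mackey topology of a Hilbert space is its norm topology.) -/
structure HilbertInterspace (R : RiggedSpace H) where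
  E : Type u
  [normedAddCommGroup : NormedAddCommGroup E]
  [innerProductSpace : InnerProductSpace ℂ E]
  [completeSpace : CompleteSpace E]
  fromD : R.D →L[ℂ] E
  toDual : E →L[ℂ] ConjDual R.D
  dense_fromD : DenseRange fromD
  toDual_injective : Function.Injective toDual
  toDual_fromD : ∀ ξ, toDual (fromD ξ) = R.embed (R.incl ξ)

attribute [instance] HilbertInterspace.normedAddCommGroup HilbertInterspace.innerProductSpace
  HilbertInterspace.completeSpace

variable {R : RiggedSpace H}

/-- The inclusion `E ⊆ F` of interspaces, as subspaces of `D^×`. -/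
def HilbertInterspace.Sub (E F : HilbertInterspace R) : Prop :=
  LinearMap.range E.toDual.toLinearMap ≤ LinearMap.range F.toDual.toLinearMap

/-- For `E ⊆ F`, the identity `I_E`, considered as a map from `E` into `F`. -/
noncomputable def HilbertInterspace.identity {E F : HilbertInterspace R} (h : E.Sub F) :
    E.E →ₗ[ℂ] F.E :=
  (LinearEquiv.ofInjective F.toDual.toLinearMap F.toDual_injective).symm.toLinearMap ∘ₗ
    Submodule.inclusion h ∘ₗ E.toDual.toLinearMap.rangeRestrict

theorem HilbertInterspace.toDual_identity {E F : HilbertInterspace R} (h : E.Sub F) (e : E.E) :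
    F.toDual (HilbertInterspace.identity h e) = E.toDual e := by
  have := LinearEquiv.apply_symm_apply
    (LinearEquiv.ofInjective F.toDual.toLinearMap F.toDual_injective)
    (Submodule.inclusion h (E.toDual.toLinearMap.rangeRestrict e))
  exact congrArg Subtype.val this

/-- `Y : E → F` is the continuous extension `X_E` of `X ∈ 𝔏(D, D^×)`. Thus `X ∈ 𝒞(E, F)` if and
only if such a `Y` exists; it is unique since `D` is dense in `E`. -/
def IsExtension (X : R.D →L[ℂ] ConjDual R.D) {E F : HilbertInterspace R} (Y : E.E →L[ℂ] F.E) :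
    Prop :=
  ∀ ξ : R.D, F.toDual (Y (E.fromD ξ)) = X ξ

/-- `X_E - lam I_E`, as a map from `E` into `F ⊇ E`. -/
noncomputable def shifted {E F : HilbertInterspace R} (h : E.Sub F) (Y : E.E →L[ℂ] F.E) (lam : ℂ) :
    E.E →ₗ[ℂ] F.E :=
  Y.toLinearMap - lam • HilbertInterspace.identity h

/-- `ϱ_{E,F}(X)`: the set of `lam` such that `X_E - lam I_E` has an inverse in `ℬ(F, E)`. It is
empty by convention if `E ⊆ F` fails or `X` does not belong to `𝒞(E, F)`. -/
def pairResolventSet (E F : HilbertInterspace R) (X : R.D →L[ℂ] ConjDual R.D) : Set ℂ :=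
  {lam | ∃ (h : E.Sub F) (Y : E.E →L[ℂ] F.E), IsExtension X Y ∧
    ∃ Z : F.E →L[ℂ] E.E, (∀ e, Z (shifted h Y lam e) = e) ∧ (∀ f, shifted h Y lam (Z f) = f)}

/-- The `𝔉₀`-resolvent set of `X ∈ 𝔏(D, D^×)`: the set of `lam` for which there are `E ⊆ F` in `𝔉₀`
with `X ∈ 𝒞(E, F)`, `(X_E - lam I_E) E = F`, such that `(X_E - lam I_E)⁻¹` exists and is continuous
from `F` onto `E`. -/
def familyResolventSet (F₀ : Set (HilbertInterspace R)) (X : R.D →L[ℂ] ConjDual R.D) : Set ℂ :=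
  {lam | ∃ E ∈ F₀, ∃ F ∈ F₀, ∃ (h : E.Sub F) (Y : E.E →L[ℂ] F.E), IsExtension X Y ∧
    Function.Surjective (shifted h Y lam) ∧
    ∃ Z : F.E →L[ℂ] E.E, ∀ e, Z (shifted h Y lam e) = e}

/-- The usual resolvent set of an unbounded operator `A` in `H`: the set of `lam` such that
`A - lam I : D(A) → H` is bijective with bounded inverse. -/
def operatorResolventSet (A : H →ₗ.[ℂ] H) : Set ℂ :=
  {lam | ∃ Z : H →L[ℂ] H, (∀ x : A.domain, Z (A x - lam • (x : H)) = x) ∧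
    ∀ y : H, ∃ x : A.domain, (x : H) = Z y ∧ A x - lam • (x : H) = y}

end General

/-! ### The rigged Hilbert space and the Hilbert scale of a self-adjoint operator -/

section Scale

variable {H : Type u} [NormedAddCommGroup H] [InnerProductSpace ℂ H]

/-- `D^∞(A) = ⋂ₙ D(Aⁿ)`. -/
noncomputable def smoothSubmodule (A : H →ₗ.[ℂ] H) : Submodule ℂ H := ⨅ n, (powPMap A n).domain

/-- `D^∞(A)` as a space of its own (with the topology `t_A`, see below). -/
def SmoothSpace (A : H →ₗ.[ℂ] H) : Type u := smoothSubmodule A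

noncomputable instance (A : H →ₗ.[ℂ] H) : AddCommGroup (SmoothSpace A) :=
  inferInstanceAs (AddCommGroup (smoothSubmodule A))

noncomputable instance (A : H →ₗ.[ℂ] H) : Module ℂ (SmoothSpace A) :=
  inferInstanceAs (Module ℂ (smoothSubmodule A))

theorem SmoothSpace.mem {A : H →ₗ.[ℂ] H} (x : SmoothSpace A) (n : ℕ) :
    (Subtype.val x : H) ∈ (powPMap A n).domain := (Submodule.mem_iInf _).1 x.2 n

/-- `Aⁿ` as a linear map from `D^∞(A)` to `H`. -/
noncomputable def SmoothSpace.pow (A : H →ₗ.[ℂ] H) (n : ℕ) : SmoothSpace A →ₗ[ℂ] H :=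
  (powPMap A n).toFun ∘ₗ Submodule.inclusion (iInf_le (fun n => (powPMap A n).domain) n)

theorem SmoothSpace.pow_graph (A : H →ₗ.[ℂ] H) (n : ℕ) (x : SmoothSpace A) :
    (Subtype.val x, SmoothSpace.pow A n x) ∈ (powPMap A n).graph :=
  (powPMap A n).mem_graph ⟨x.1, x.mem n⟩

/-- The seminorms `p_n(ξ) = ‖Aⁿ ξ‖` on `D^∞(A)`. -/
noncomputable def SmoothSpace.seminorms (A : H →ₗ.[ℂ] H) : SeminormFamily ℂ (SmoothSpace A) ℕ :=
  fun n => (normSeminorm ℂ H).comp (SmoothSpace.pow A n)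

/-- The topology `t_A` on `D^∞(A)`, generated by the seminorms `p_n`. -/
noncomputable instance (A : H →ₗ.[ℂ] H) : TopologicalSpace (SmoothSpace A) :=
  (SmoothSpace.seminorms A).moduleFilterBasis.topology

theorem SmoothSpace.withSeminorms (A : H →ₗ.[ℂ] H) : WithSeminorms (SmoothSpace.seminorms A) :=
  ⟨rfl⟩

instance (A : H →ₗ.[ℂ] H) : IsTopologicalAddGroup (SmoothSpace A) :=
  (SmoothSpace.withSeminorms A).topologicalAddGroup

instance (A : H →ₗ.[ℂ] H) : ContinuousSMul ℂ (SmoothSpace A) :=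
  (SmoothSpace.withSeminorms A).continuousSMul

instance (A : H →ₗ.[ℂ] H) : PolynormableSpace ℂ (SmoothSpace A) :=
  (SmoothSpace.withSeminorms A).toPolynormableSpace

/-- `Aⁿ : D^∞(A) → H` is continuous. -/
noncomputable def SmoothSpace.powL (A : H →ₗ.[ℂ] H) (n : ℕ) : SmoothSpace A →L[ℂ] H where
  toLinearMap := SmoothSpace.pow A n
  cont := (SmoothSpace.withSeminorms A).continuous_normedSpace_rng H _ ⟨{n}, 1, fun x => by
    simp [SmoothSpace.seminorms]⟩

variable [CompleteSpace H] {A : H →ₗ.[ℂ] H}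

theorem smoothing_mem_smooth (hA : IsSelfAdjoint A) (k : ℕ) (x : H) :
    smoothing hA k x ∈ smoothSubmodule A :=
  (Submodule.mem_iInf _).2 fun n => smoothing_mem hA k n x

/-- The rigged Hilbert space generated by a self-adjoint operator `A`, with `D = D^∞(A)`. -/
noncomputable def riggedSpace (hA : IsSelfAdjoint A) : RiggedSpace H where
  D := SmoothSpace A
  incl := SmoothSpace.powL A 0
  incl_injective := by
    intro x y h
    exact Subtype.ext h
  incl_dense := fun x =>
    mem_closure_of_tendsto (smoothing_tendsto hA x) (Filter.Eventually.of_forall fun k =>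
      ⟨⟨_, smoothing_mem_smooth hA (k + 1) x⟩, rfl⟩)

/-- The operator `S`: the restriction of `A` to `D = D^∞(A)`, as an element of `𝔏(D, D^×)`. -/
noncomputable def restriction (hA : IsSelfAdjoint A) :
    (riggedSpace hA).D →L[ℂ] ConjDual (riggedSpace hA).D :=
  (riggedSpace hA).embed ∘L SmoothSpace.powL A 1

/-- `S` acts as `A`. -/
theorem restriction_apply (hA : IsSelfAdjoint A) (ξ : SmoothSpace A) (h : ξ.1 ∈ A.domain) :
    restriction hA ξ = (riggedSpace hA).embed (A ⟨ξ.1, h⟩) := by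
  have h1 := (mem_powPMap_one A _ _).1 (SmoothSpace.pow_graph A 1 ξ)
  rw [graph_apply h1 h]
  rfl

/-- The inclusion of `D^∞(A)` in `D(Aⁿ)`, as a linear map. -/
noncomputable def toPowSpaceₗ (hA : IsSelfAdjoint A) (n : ℕ) :
    SmoothSpace A →ₗ[ℂ] GraphSpace (pow_isSelfAdjoint hA n) where
  toFun x := ⟨WithLp.toLp 2 (SmoothSpace.pow A 0 x, SmoothSpace.pow A n x),
    SmoothSpace.pow_graph A n x⟩
  map_add' x y := by
    refine Subtype.ext ?_
    simp only [map_add]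
    rfl
  map_smul' c x := by
    refine Subtype.ext ?_
    simp only [map_smul]
    rfl

/-- The continuous inclusion of `D^∞(A)` in `D(Aⁿ)`. -/
noncomputable def toPowSpace (hA : IsSelfAdjoint A) (n : ℕ) :
    SmoothSpace A →L[ℂ] GraphSpace (pow_isSelfAdjoint hA n) where
  toLinearMap := toPowSpaceₗ hA n
  cont := by
    refine (SmoothSpace.withSeminorms A).continuous_normedSpace_rng
      (GraphSpace (pow_isSelfAdjoint hA n)) (toPowSpaceₗ hA n) ⟨{0, n}, 2, fun x => ?_⟩
    set s := ({0, n} : Finset ℕ).sup (SmoothSpace.seminorms A)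
    have h0 : SmoothSpace.seminorms A 0 ≤ s := Finset.le_sup (by simp)
    have hn : SmoothSpace.seminorms A n ≤ s := Finset.le_sup (by simp)
    set w : GraphSpace (pow_isSelfAdjoint hA n) :=
      ⟨WithLp.toLp 2 (SmoothSpace.pow A 0 x, SmoothSpace.pow A n x), SmoothSpace.pow_graph A n x⟩
    have h : ‖w‖ ≤ s x + s x :=
      (GraphSpace.norm_le (pow_isSelfAdjoint hA n) w).trans (add_le_add (h0 x) (hn x))
    refine le_trans h (le_of_eq ?_)
    rw [← two_mul]
    rfl

theorem toPowSpace_dense (hA : IsSelfAdjoint A) (n : ℕ) : DenseRange (toPowSpace hA n) := by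
  intro w
  refine mem_closure_of_tendsto (f := fun k : ℕ => toPowSpace hA n
    ⟨_, smoothing_mem_smooth hA (k + 1) (GraphSpace.incl _ w)⟩) (b := Filter.atTop) ?_
    (Filter.Eventually.of_forall fun k => ⟨_, rfl⟩)
  rw [tendsto_iff_norm_sub_tendsto_zero]
  have h3 : Filter.Tendsto (fun k =>
      ‖smoothing hA (k + 1) (GraphSpace.incl _ w) - GraphSpace.incl _ w‖ +
      ‖smoothing hA (k + 1) (GraphSpace.op _ w) - GraphSpace.op (pow_isSelfAdjoint hA n) w‖)
      Filter.atTop (nhds 0) := by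
    simpa using (tendsto_iff_norm_sub_tendsto_zero.1 (smoothing_tendsto hA _)).add
      (tendsto_iff_norm_sub_tendsto_zero.1 (smoothing_tendsto hA _))
  refine squeeze_zero (fun _ => norm_nonneg _) (fun k => ?_) h3
  refine (GraphSpace.norm_le _ _).trans (le_of_eq ?_)
  rw [map_sub, map_sub]
  have h4 := smoothing_graph hA (k + 1) n (GraphSpace.graph (pow_isSelfAdjoint hA n) w)
  have h5 := GraphSpace.graph (pow_isSelfAdjoint hA n) (toPowSpace hA n
    ⟨_, smoothing_mem_smooth hA (k + 1) (GraphSpace.incl _ w)⟩)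
  rw [graph_unique h4 h5]
  rfl

theorem toConjDual_injective {D K : Type u} [AddCommGroup D] [Module ℂ D]
    [TopologicalSpace D] [IsTopologicalAddGroup D] [ContinuousSMul ℂ D]
    [NormedAddCommGroup K] [InnerProductSpace ℂ K] (i : D →L[ℂ] K) (hi : DenseRange i) :
    Function.Injective (toConjDual i) := by
  intro x y h
  exact hi.eq_of_inner_right ℂ fun d => DFunLike.congr_fun h d

/-- `ℋ_0 = H`. -/
noncomputable def scaleZero (hA : IsSelfAdjoint A) : HilbertInterspace (riggedSpace hA) where
  E := H
  fromD := (riggedSpace hA).incl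
  toDual := (riggedSpace hA).embed
  dense_fromD := (riggedSpace hA).incl_dense
  toDual_injective := toConjDual_injective _ (riggedSpace hA).incl_dense
  toDual_fromD _ := rfl

/-- `ℋ_n`, `n > 0`: the domain `D(Aⁿ)` with the graph norm `(‖ξ‖² + ‖Aⁿ ξ‖²)^{1/2}`, which equals
`‖(I + A^{2n})^{1/2} ξ‖`. -/
noncomputable def scalePos (hA : IsSelfAdjoint A) (n : ℕ) : HilbertInterspace (riggedSpace hA) where
  E := GraphSpace (pow_isSelfAdjoint hA n)
  fromD := toPowSpace hA n
  toDual := (riggedSpace hA).embed ∘L GraphSpace.incl (pow_isSelfAdjoint hA n)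
  dense_fromD := toPowSpace_dense hA n
  toDual_injective := (toConjDual_injective _ (riggedSpace hA).incl_dense).comp
    (GraphSpace.incl_injective _)
  toDual_fromD _ := rfl

section Negative

variable {T : H →ₗ.[ℂ] H}

/-- The space `H` with the norm `‖ξ‖ = ‖(I + T²)^{-1/2} ξ‖`. -/
def NegSpace (_hT : IsSelfAdjoint T) : Type u := H

noncomputable instance (hT : IsSelfAdjoint T) : AddCommGroup (NegSpace hT) :=
  inferInstanceAs (AddCommGroup H)

noncomputable instance (hT : IsSelfAdjoint T) : Module ℂ (NegSpace hT) :=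
  inferInstanceAs (Module ℂ H)

/-- The identity map `H → NegSpace`. -/
noncomputable def NegSpace.equiv (hT : IsSelfAdjoint T) : H ≃ₗ[ℂ] NegSpace hT :=
  LinearEquiv.refl ℂ H

/-- `(I + T²)^{-1/2}`, whose norm defines the norm of `NegSpace`. -/
noncomputable def NegSpace.weight (hT : IsSelfAdjoint T) : NegSpace hT →ₗ[ℂ] H :=
  (invSqrtOneAddSq hT).toLinearMap ∘ₗ (NegSpace.equiv hT).symm.toLinearMap

noncomputable instance (hT : IsSelfAdjoint T) : SeminormedAddCommGroup (NegSpace hT) :=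
  SeminormedAddCommGroup.induced (NegSpace hT) H (NegSpace.weight hT)

noncomputable instance (hT : IsSelfAdjoint T) : NormedSpace ℂ (NegSpace hT) :=
  NormedSpace.induced ℂ (NegSpace hT) H (NegSpace.weight hT)

theorem NegSpace.norm_eq (hT : IsSelfAdjoint T) (x : H) :
    ‖NegSpace.equiv hT x‖ = ‖invSqrtOneAddSq hT x‖ := rfl

noncomputable instance (hT : IsSelfAdjoint T) : InnerProductSpace ℂ (NegSpace hT) where
  inner x y := inner ℂ (NegSpace.weight hT x) (NegSpace.weight hT y)
  norm_sq_eq_re_inner x := (inner_self_eq_norm_sq (𝕜 := ℂ) (NegSpace.weight hT x)).symm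
  conj_inner_symm x y := inner_conj_symm _ _
  add_left x y z := by rw [map_add, inner_add_left]
  smul_left x y r := by rw [map_smul, inner_smul_left]

/-- The map `ξ ↦ (η ↦ ⟨ξ, η⟩)` from `H`, with the norm `‖(I + T²)^{-1/2} ξ‖`, to the conjugate dual
of `D(T)`; it is isometric. -/
noncomputable def NegSpace.toDual (hT : IsSelfAdjoint T) :
    NegSpace hT →ₗᵢ[ℂ] ConjDual (GraphSpace hT) where
  toLinearMap := (toConjDual (GraphSpace.incl hT)).toLinearMap ∘ₗ (NegSpace.equiv hT).symm.toLinearMap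
  norm_map' x := by
    obtain ⟨x, rfl⟩ := (NegSpace.equiv hT).surjective x
    rw [NegSpace.norm_eq, norm_invSqrtOneAddSq]
    have h : ∀ η, toConjDual (GraphSpace.incl hT) x η =
        inner ℂ η (ContinuousLinearMap.adjoint (GraphSpace.incl hT) x) := fun η => by
      rw [ContinuousLinearMap.adjoint_inner_right]
      rfl
    change ‖toConjDual (GraphSpace.incl hT) x‖ = _
    set v := ContinuousLinearMap.adjoint (GraphSpace.incl hT) x
    refine le_antisymm ?_ ?_
    · refine ContinuousLinearMap.opNorm_le_bound _ (norm_nonneg _) fun η => ?_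
      rw [h, mul_comm]
      exact norm_inner_le_norm η v
    · rcases eq_or_lt_of_le (norm_nonneg v) with h0 | h0
      · rw [← h0]
        exact norm_nonneg (toConjDual (GraphSpace.incl hT) x)
      · have h1 := (toConjDual (GraphSpace.incl hT) x).le_opNorm v
        rw [h, inner_self_eq_norm_sq_to_K (𝕜 := ℂ) v] at h1
        have h2 : ‖((‖v‖ : ℂ)) ^ 2‖ = ‖v‖ * ‖v‖ := by simp [sq]
        exact le_of_mul_le_mul_right (h2 ▸ h1) h0

/-- The extension by continuity of `NegSpace.toDual` to the completion. -/
noncomputable def NegSpace.completionToDual (hT : IsSelfAdjoint T) :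
    UniformSpace.Completion (NegSpace hT) →L[ℂ] ConjDual (GraphSpace hT) :=
  (NegSpace.toDual hT).toContinuousLinearMap.extend UniformSpace.Completion.toComplL

theorem NegSpace.completionToDual_coe (hT : IsSelfAdjoint T) (x : NegSpace hT) :
    NegSpace.completionToDual hT x = NegSpace.toDual hT x :=
  ContinuousLinearMap.extend_eq _ (e := UniformSpace.Completion.toComplL (𝕜 := ℂ))
    UniformSpace.Completion.denseRange_coe (UniformSpace.Completion.isUniformInducing_coe _) x

theorem NegSpace.norm_completionToDual (hT : IsSelfAdjoint T)
    (x : UniformSpace.Completion (NegSpace hT)) : ‖NegSpace.completionToDual hT x‖ = ‖x‖ := by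
  induction x using UniformSpace.Completion.induction_on with
  | hp =>
    have h : Continuous fun f : ConjDual (GraphSpace hT) => ‖f‖ := continuous_norm_conjDual
    exact isClosed_eq (h.comp (NegSpace.completionToDual hT).continuous) continuous_norm
  | ih x =>
    rw [NegSpace.completionToDual_coe, LinearIsometry.norm_map, UniformSpace.Completion.norm_coe]

/-- The identity map of `H` into its completion, continuous for the original norm of `H`. -/
noncomputable def NegSpace.ofH (hT : IsSelfAdjoint T) :
    H →L[ℂ] UniformSpace.Completion (NegSpace hT) :=
  UniformSpace.Completion.toComplL ∘L
    (NegSpace.equiv hT).toLinearMap.mkContinuous ‖invSqrtOneAddSq hT‖ fun x =>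
      (NegSpace.norm_eq hT x).le.trans ((invSqrtOneAddSq hT).le_opNorm x)

theorem NegSpace.ofH_dense (hT : IsSelfAdjoint T) : DenseRange (NegSpace.ofH hT) := by
  have h : Set.range (NegSpace.ofH hT) =
      Set.range ((↑) : NegSpace hT → UniformSpace.Completion (NegSpace hT)) := by
    ext y
    exact ⟨fun ⟨x, hx⟩ => ⟨NegSpace.equiv hT x, hx⟩, fun ⟨x, hx⟩ => ⟨(NegSpace.equiv hT).symm x, hx⟩⟩
  rw [DenseRange, h]
  exact UniformSpace.Completion.denseRange_coe

end Negative

/-- `ℋ_{-n}`, `n > 0`: the completion of `H` with respect to the norm `‖(I + A^{2n})^{-1/2} ξ‖`. -/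
noncomputable def scaleNeg (hA : IsSelfAdjoint A) (n : ℕ) : HilbertInterspace (riggedSpace hA) where
  E := UniformSpace.Completion (NegSpace (pow_isSelfAdjoint hA n))
  fromD := NegSpace.ofH (pow_isSelfAdjoint hA n) ∘L (riggedSpace hA).incl
  toDual := (ContinuousLinearMap.precomp ℂ (toPowSpace hA n)) ∘L
    NegSpace.completionToDual (pow_isSelfAdjoint hA n)
  dense_fromD := (NegSpace.ofH_dense _).comp (riggedSpace hA).incl_dense
    (NegSpace.ofH _).continuous
  toDual_injective := by
    rw [injective_iff_map_eq_zero]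
    intro x hx
    have h : NegSpace.completionToDual (pow_isSelfAdjoint hA n) x = 0 := by
      refine DFunLike.coe_injective ((toPowSpace_dense hA n).equalizer
        (ContinuousLinearMap.continuous _) (ContinuousLinearMap.continuous _) ?_)
      funext d
      exact DFunLike.congr_fun hx d
    rw [← norm_eq_zero, ← NegSpace.norm_completionToDual, h]
    exact norm_zero (E := ConjDual (GraphSpace (pow_isSelfAdjoint hA n)))
  toDual_fromD ξ := by
    have h := NegSpace.completionToDual_coe (pow_isSelfAdjoint hA n)
      (NegSpace.equiv _ ((riggedSpace hA).incl ξ))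
    ext η
    exact DFunLike.congr_fun h (toPowSpace hA n η)

/-- The space `ℋ_n`, `n ∈ ℤ`, of the Hilbert scale generated by `A`. -/
noncomputable def scale (hA : IsSelfAdjoint A) : ℤ → HilbertInterspace (riggedSpace hA)
  | .ofNat 0 => scaleZero hA
  | .ofNat (n + 1) => scalePos hA (n + 1)
  | .negSucc n => scaleNeg hA (n + 1)

end Scale

end RiggedResolvent

/-! On $\mathcal D=\mathcal D^\infty(A)$ the operator $A-i$ is a bijection:
$\|(A-i)x\|^2=\|Ax\|^2+\|x\|^2$ gives injectivity, and $(A-i)(A+i)=A^2+1$, with $(1+A^2)^{-1}$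
preserving $\mathcal D$, gives surjectivity. So $(A-i)^k$ makes sense on $\mathcal D$ for every
$k\in\mathbb Z$ and commutes with $A$. The key fact is `scale_norm_equiv`: on $\mathcal D$ the norm
of $\mathcal H_n$ is equivalent to $\|(A-i)^n x\|$. Every estimate between $\mathcal H_n$ and
$\mathcal H_m$ then becomes an estimate in $\mathcal H$ involving only $n-m$.

An inclusion $\mathcal H_n\subseteq\mathcal H_m$ is bounded by the closed graph theorem and yields
$\|x\|\le C\|(A-i)^{n-m}x\|$. A bounded left inverse of $S-\lambda$ yields $\|(A-i)^{n-m}x\|\le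
C\|(A-\lambda)x\|$. Together they bound $A-\lambda$ below on $\mathcal D$, and surjectivity onto
$\mathcal H_m$ makes $(A-\lambda)\mathcal D$ dense in $\mathcal H$. As $A$ is closed with core
$\mathcal D$, this puts $\lambda$ in the usual resolvent set (`mem_operatorResolventSet`).
Conversely, the pair $(\mathcal H_1,\mathcal H_0)$ realises every $\lambda$ of the usual resolvent
set.

The same inequalities force $A$ to be everywhere defined when $m\ne n-1$
(`domain_eq_top_of_leftInverse`): the inclusion does so if $n<m$, the boundedness of $S$ on
$\mathcal H_n$ if $n=m$, and the bounded inverse if $n\ge m+2$. -/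

namespace RiggedResolvent

/-! ### The operators $A$ and $A\pm i$ on $\mathcal D^\infty(A)$. -/

section SmoothEndomorphisms

variable {H : Type u} [NormedAddCommGroup H] [InnerProductSpace ℂ H]

/-- The inclusion of `D^∞(A)` in `H`, as a linear map. -/
noncomputable def SmoothSpace.val (A : H →ₗ.[ℂ] H) : SmoothSpace A →ₗ[ℂ] H :=
  (smoothSubmodule A).subtype

theorem SmoothSpace.val_injective (A : H →ₗ.[ℂ] H) : Function.Injective (SmoothSpace.val A) :=
  Subtype.val_injective

theorem SmoothSpace.pow_graph' (A : H →ₗ.[ℂ] H) (n : ℕ) (x : SmoothSpace A) :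
    (SmoothSpace.val A x, SmoothSpace.pow A n x) ∈ (powPMap A n).graph :=
  SmoothSpace.pow_graph A n x

theorem SmoothSpace.pow_one_mem (A : H →ₗ.[ℂ] H) (x : SmoothSpace A) :
    SmoothSpace.pow A 1 x ∈ smoothSubmodule A := by
  refine (Submodule.mem_iInf _).2 fun n => ?_
  obtain ⟨y, hy, hz⟩ := (mem_powPMap_succ' _ _ _ _).1 (SmoothSpace.pow_graph A (n + 1) x)
  have h1 := (mem_powPMap_one A _ _).1 (SmoothSpace.pow_graph A 1 x)
  rw [graph_unique h1 hy]
  exact mem_domain_of_graph hz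

/-- The restriction of `A` to an endomorphism of `D^∞(A)`. -/
noncomputable def SmoothSpace.op (A : H →ₗ.[ℂ] H) : SmoothSpace A →ₗ[ℂ] SmoothSpace A :=
  LinearMap.codRestrict (smoothSubmodule A) (SmoothSpace.pow A 1) (SmoothSpace.pow_one_mem A)

theorem SmoothSpace.op_graph (A : H →ₗ.[ℂ] H) (x : SmoothSpace A) :
    (SmoothSpace.val A x, SmoothSpace.val A (SmoothSpace.op A x)) ∈ A.graph :=
  (mem_powPMap_one A _ _).1 (SmoothSpace.pow_graph A 1 x)

theorem SmoothSpace.op_pow_graph (A : H →ₗ.[ℂ] H) (n : ℕ) (x : SmoothSpace A) :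
    (SmoothSpace.val A x, SmoothSpace.val A ((SmoothSpace.op A ^ n) x)) ∈ (powPMap A n).graph := by
  induction n with
  | zero => exact (mem_powPMap_zero _ _ _).2 rfl
  | succ n ih =>
    refine (mem_powPMap_succ _ _ _ _).2 ⟨_, ih, ?_⟩
    rw [pow_succ']
    exact SmoothSpace.op_graph A _

theorem SmoothSpace.val_op_pow (A : H →ₗ.[ℂ] H) (n : ℕ) (x : SmoothSpace A) :
    SmoothSpace.val A ((SmoothSpace.op A ^ n) x) = SmoothSpace.pow A n x :=
  graph_unique (SmoothSpace.op_pow_graph A n x) (SmoothSpace.pow_graph' A n x)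

/-- The operator `A + i` on `D^∞(A)`. -/
noncomputable def SmoothSpace.addI (A : H →ₗ.[ℂ] H) : SmoothSpace A →ₗ[ℂ] SmoothSpace A :=
  -- The form $A-c$ with $c=-i$ lets the lemmas on $A-c$ serve both signs.
  SmoothSpace.op A - (-Complex.I) • LinearMap.id

theorem SmoothSpace.addI_apply {A : H →ₗ.[ℂ] H} (x : SmoothSpace A) :
    SmoothSpace.addI A x = SmoothSpace.op A x - (-Complex.I) • x := rfl

variable [CompleteSpace H] {A : H →ₗ.[ℂ] H}

theorem SmoothSpace.inner_op (hA : IsSelfAdjoint A) (x y : SmoothSpace A) :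
    (inner ℂ (SmoothSpace.val A (SmoothSpace.op A x)) (SmoothSpace.val A y) : ℂ) =
      inner ℂ (SmoothSpace.val A x) (SmoothSpace.val A (SmoothSpace.op A y)) :=
  graph_symm hA (SmoothSpace.op_graph A x) (SmoothSpace.op_graph A y)

/-- Symmetry makes $\langle Ax,x\rangle$ real, so for purely imaginary $c$ the cross term in the
expansion of the square vanishes. -/
theorem SmoothSpace.norm_op_sub_sq (hA : IsSelfAdjoint A) {c : ℂ} (hc : c.re = 0) (x : SmoothSpace A) :
    ‖SmoothSpace.val A (SmoothSpace.op A x - c • x)‖ ^ 2 =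
      ‖SmoothSpace.val A (SmoothSpace.op A x)‖ ^ 2 + ‖c‖ ^ 2 * ‖SmoothSpace.val A x‖ ^ 2 := by
  have h1 : (inner ℂ (SmoothSpace.val A (SmoothSpace.op A x)) (SmoothSpace.val A x) : ℂ).im = 0 := by
    have h := inner_conj_symm (𝕜 := ℂ) (SmoothSpace.val A x) (SmoothSpace.val A (SmoothSpace.op A x))
    rw [← SmoothSpace.inner_op hA] at h
    exact Complex.conj_eq_iff_im.1 h
  rw [map_sub, map_smul, @norm_sub_sq ℂ, inner_smul_right, norm_smul, mul_pow]
  have h2 : RCLike.re (c * inner ℂ (SmoothSpace.val A (SmoothSpace.op A x)) (SmoothSpace.val A x))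
      = 0 := by
    change (c * inner ℂ (SmoothSpace.val A (SmoothSpace.op A x)) (SmoothSpace.val A x)).re = 0
    rw [Complex.mul_re, h1, hc]
    ring
  rw [h2]
  ring

/-- The bounded operator $(I+A^2)^{-1}$ commutes with all powers of $A$, hence preserves $\mathcal
D^\infty(A)$ and supplies the solution. -/
theorem SmoothSpace.exists_op_sq_add (hA : IsSelfAdjoint A) (y : SmoothSpace A) :
    ∃ x, SmoothSpace.op A (SmoothSpace.op A x) + x = y := by
  have hm : invOneAddSq hA (SmoothSpace.val A y) ∈ smoothSubmodule A :=
    (Submodule.mem_iInf _).2 fun n =>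
      mem_domain_of_graph (invOneAddSq_pow_graph hA n (SmoothSpace.pow_graph' A n y))
  set x : SmoothSpace A := ⟨_, hm⟩
  have h1 : (SmoothSpace.val A x, SmoothSpace.val A (SmoothSpace.op A (SmoothSpace.op A x))) ∈
      (mulPMap A A).graph :=
    (mem_mulPMap_graph _ _ _ _).2 ⟨_, SmoothSpace.op_graph A x, SmoothSpace.op_graph A _⟩
  refine ⟨x, SmoothSpace.val_injective A ?_⟩
  rw [map_add, graph_unique h1 (invOneAddSq_spec hA (SmoothSpace.val A y))]
  exact sub_add_cancel _ _

/-- Since $c^2=-1$, $(A-c)(A+c)=A^2+1$, which is already known to be onto. -/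
theorem SmoothSpace.op_sub_surjective (hA : IsSelfAdjoint A) {c : ℂ} (hc : c * c = -1) :
    Function.Surjective (SmoothSpace.op A - c • (LinearMap.id : SmoothSpace A →ₗ[ℂ] SmoothSpace A)) := by
  intro y
  obtain ⟨x, hx⟩ := SmoothSpace.exists_op_sq_add hA y
  refine ⟨SmoothSpace.op A x + c • x, ?_⟩
  rw [← hx]
  simp only [LinearMap.sub_apply, LinearMap.smul_apply, LinearMap.id_apply, map_add, map_smul,
    smul_sub, smul_smul, hc]
  rw [neg_one_smul]
  abel

theorem SmoothSpace.op_sub_injective (hA : IsSelfAdjoint A) {c : ℂ} (hc : c.re = 0) (h0 : c ≠ 0) :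
    Function.Injective (SmoothSpace.op A - c • (LinearMap.id : SmoothSpace A →ₗ[ℂ] SmoothSpace A)) := by
  rw [injective_iff_map_eq_zero]
  intro x hx
  have h := SmoothSpace.norm_op_sub_sq hA hc x
  rw [show SmoothSpace.op A x - c • x = 0 from hx, map_zero, norm_zero] at h
  have h1 : 0 < ‖c‖ ^ 2 := by positivity
  have h2 : ‖SmoothSpace.val A x‖ ^ 2 = 0 := by
    nlinarith [sq_nonneg ‖SmoothSpace.val A (SmoothSpace.op A x)‖, sq_nonneg ‖SmoothSpace.val A x‖]
  rw [sq_eq_zero_iff, norm_eq_zero] at h2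
  exact SmoothSpace.val_injective A (h2.trans (map_zero _).symm)

/-- The operator `A - i`, as an automorphism of `D^∞(A)`. -/
noncomputable def SmoothSpace.subI (hA : IsSelfAdjoint A) : SmoothSpace A ≃ₗ[ℂ] SmoothSpace A :=
  LinearEquiv.ofBijective (SmoothSpace.op A - Complex.I • LinearMap.id)
    ⟨SmoothSpace.op_sub_injective hA Complex.I_re Complex.I_ne_zero,
      SmoothSpace.op_sub_surjective hA Complex.I_mul_I⟩

theorem SmoothSpace.subI_apply (hA : IsSelfAdjoint A) (x : SmoothSpace A) :
    SmoothSpace.subI hA x = SmoothSpace.op A x - Complex.I • x := rfl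

theorem SmoothSpace.norm_subI_sq (hA : IsSelfAdjoint A) (x : SmoothSpace A) :
    ‖SmoothSpace.val A (SmoothSpace.subI hA x)‖ ^ 2 =
      ‖SmoothSpace.val A (SmoothSpace.op A x)‖ ^ 2 + ‖SmoothSpace.val A x‖ ^ 2 := by
  rw [SmoothSpace.subI_apply, SmoothSpace.norm_op_sub_sq hA Complex.I_re]
  simp

theorem SmoothSpace.norm_op_le (hA : IsSelfAdjoint A) (x : SmoothSpace A) :
    ‖SmoothSpace.val A (SmoothSpace.op A x)‖ ≤ ‖SmoothSpace.val A (SmoothSpace.subI hA x)‖ := by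
  refine le_of_sq_le_sq ?_ (norm_nonneg _)
  rw [SmoothSpace.norm_subI_sq]
  nlinarith [sq_nonneg ‖SmoothSpace.val A x‖]

theorem SmoothSpace.norm_le_subI (hA : IsSelfAdjoint A) (x : SmoothSpace A) :
    ‖SmoothSpace.val A x‖ ≤ ‖SmoothSpace.val A (SmoothSpace.subI hA x)‖ := by
  refine le_of_sq_le_sq ?_ (norm_nonneg _)
  rw [SmoothSpace.norm_subI_sq]
  nlinarith [sq_nonneg ‖SmoothSpace.val A (SmoothSpace.op A x)‖]

theorem SmoothSpace.norm_subI_le (hA : IsSelfAdjoint A) (x : SmoothSpace A) :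
    ‖SmoothSpace.val A (SmoothSpace.subI hA x)‖ ≤
      ‖SmoothSpace.val A (SmoothSpace.op A x)‖ + ‖SmoothSpace.val A x‖ := by
  rw [SmoothSpace.subI_apply, map_sub, map_smul]
  refine (norm_sub_le _ _).trans (le_of_eq ?_)
  rw [norm_smul, Complex.norm_I, one_mul]

/-! ### Integer powers of $A-i$ and the graph norms of $A^n$. -/

theorem SmoothSpace.subI_zpow_add (hA : IsSelfAdjoint A) (m n : ℤ) (x : SmoothSpace A) :
    (SmoothSpace.subI hA ^ (m + n)) x = (SmoothSpace.subI hA ^ m) ((SmoothSpace.subI hA ^ n) x) := by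
  rw [zpow_add]
  rfl

theorem SmoothSpace.subI_zpow_one_add (hA : IsSelfAdjoint A) (n : ℤ) (x : SmoothSpace A) :
    (SmoothSpace.subI hA ^ (1 + n)) x = SmoothSpace.subI hA ((SmoothSpace.subI hA ^ n) x) := by
  rw [SmoothSpace.subI_zpow_add, zpow_one]

theorem SmoothSpace.subI_zpow_neg (hA : IsSelfAdjoint A) (n : ℤ) (x : SmoothSpace A) :
    (SmoothSpace.subI hA ^ n) ((SmoothSpace.subI hA ^ (-n)) x) = x := by
  rw [← SmoothSpace.subI_zpow_add, add_neg_cancel]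
  rfl

/-- Writing $A=(A-i)+i$ reduces this to the fact that powers of $A-i$ commute, so negative exponents
need no separate argument. -/
theorem SmoothSpace.subI_zpow_op (hA : IsSelfAdjoint A) (n : ℤ) (x : SmoothSpace A) :
    (SmoothSpace.subI hA ^ n) (SmoothSpace.op A x) = SmoothSpace.op A ((SmoothSpace.subI hA ^ n) x) := by
  have h1 : ∀ y, SmoothSpace.op A y = SmoothSpace.subI hA y + Complex.I • y := fun y => by
    rw [SmoothSpace.subI_apply, sub_add_cancel]
  rw [h1, h1, map_add, map_smul, ← SmoothSpace.subI_zpow_one_add, add_comm 1 n,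
    SmoothSpace.subI_zpow_add, zpow_one]

theorem SmoothSpace.norm_le_subI_pow (hA : IsSelfAdjoint A) (n : ℕ) (x : SmoothSpace A) :
    ‖SmoothSpace.val A x‖ ≤ ‖SmoothSpace.val A ((SmoothSpace.subI hA ^ (n : ℤ)) x)‖ := by
  induction n with
  | zero => exact le_rfl
  | succ n ih =>
    rw [Nat.cast_succ, add_comm, SmoothSpace.subI_zpow_one_add]
    exact ih.trans (SmoothSpace.norm_le_subI hA _)

theorem SmoothSpace.norm_op_pow_le (hA : IsSelfAdjoint A) (n : ℕ) (x : SmoothSpace A) :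
    ‖SmoothSpace.val A ((SmoothSpace.op A ^ n) x)‖ ≤
      ‖SmoothSpace.val A ((SmoothSpace.subI hA ^ (n : ℤ)) x)‖ := by
  induction n generalizing x with
  | zero => exact le_rfl
  | succ n ih =>
    rw [Nat.cast_succ, add_comm (n : ℤ), SmoothSpace.subI_zpow_one_add, pow_succ]
    refine (ih (SmoothSpace.op A x)).trans ?_
    rw [SmoothSpace.subI_zpow_op]
    exact SmoothSpace.norm_op_le hA _

/-- The graph norm of $A^n$ sees only the extreme powers; the first power is recovered by raising
the exponent one step at a time with `norm_pow_le`. -/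
theorem SmoothSpace.norm_op_le_max (hA : IsSelfAdjoint A) (n : ℕ) (x : SmoothSpace A) :
    ‖SmoothSpace.val A (SmoothSpace.op A x)‖ ≤
      max ‖SmoothSpace.val A x‖ ‖SmoothSpace.val A ((SmoothSpace.op A ^ (n + 1)) x)‖ := by
  induction n with
  | zero => exact le_max_of_le_right le_rfl
  | succ n ih =>
    have h := norm_pow_le hA (n + 1) (SmoothSpace.op_pow_graph A (n + 1) x)
      (SmoothSpace.op_graph A _)
    rw [pow_succ']
    exact ih.trans (max_le (le_max_left _ _) h)

/-- The bound $\|(A-i)z\|\le\|Az\|+\|z\|$ doubles the constant at each step; the intermediate powers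
that arise are absorbed by the maximum of the extreme ones. -/
theorem SmoothSpace.norm_subI_pow_le (hA : IsSelfAdjoint A) (n : ℕ) :
    ∃ C : ℝ, 0 < C ∧ ∀ x, ‖SmoothSpace.val A ((SmoothSpace.subI hA ^ (n : ℤ)) x)‖ ≤
      C * max ‖SmoothSpace.val A x‖ ‖SmoothSpace.val A ((SmoothSpace.op A ^ n) x)‖ := by
  induction n with
  | zero => exact ⟨1, one_pos, fun x => by rw [one_mul]; exact le_max_left _ _⟩
  | succ n ih =>
    obtain ⟨C, hC, h⟩ := ih
    refine ⟨C + C, by positivity, fun x => ?_⟩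
    rw [Nat.cast_succ, add_comm (n : ℤ), SmoothSpace.subI_zpow_one_add]
    refine (SmoothSpace.norm_subI_le hA _).trans ?_
    rw [← SmoothSpace.subI_zpow_op, add_mul]
    refine add_le_add ((h _).trans ?_) ((h _).trans ?_)
    · refine mul_le_mul_of_nonneg_left (max_le (SmoothSpace.norm_op_le_max hA n x) ?_) hC.le
      rw [pow_succ]
      exact le_max_right _ _
    · refine mul_le_mul_of_nonneg_left (max_le (le_max_left _ _) ?_) hC.le
      rw [pow_succ']
      exact norm_pow_le hA n (SmoothSpace.op_pow_graph A n x) (SmoothSpace.op_graph A _)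

theorem toPowSpace_norm_equiv (hA : IsSelfAdjoint A) (n : ℕ) :
    ∃ C : ℝ, 0 < C ∧ ∀ x : SmoothSpace A,
      ‖SmoothSpace.val A ((SmoothSpace.subI hA ^ (n : ℤ)) x)‖ ≤ C * ‖toPowSpace hA n x‖ ∧
      ‖toPowSpace hA n x‖ ≤ C * ‖SmoothSpace.val A ((SmoothSpace.subI hA ^ (n : ℤ)) x)‖ := by
  obtain ⟨C, hC, h⟩ := SmoothSpace.norm_subI_pow_le hA n
  -- $C$ serves the first inequality; $2$ serves the second, where $\|x\|$ and $\|A^nx\|$ are each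
  -- at most $\|(A-i)^nx\|$.
  refine ⟨C + 2, by positivity, fun x => ⟨(h x).trans ?_, ?_⟩⟩
  · have h1 := GraphSpace.norm_sq' (pow_isSelfAdjoint hA n) (toPowSpace hA n x)
    have h2 : GraphSpace.incl (pow_isSelfAdjoint hA n) (toPowSpace hA n x) = SmoothSpace.val A x := rfl
    have h3 : GraphSpace.op (pow_isSelfAdjoint hA n) (toPowSpace hA n x) =
      SmoothSpace.val A ((SmoothSpace.op A ^ n) x) := (SmoothSpace.val_op_pow A n x).symm
    rw [h2, h3] at h1
    refine mul_le_mul (by linarith) (max_le ?_ ?_) (le_max_of_le_left (norm_nonneg _))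
      (by positivity)
    · exact le_of_sq_le_sq (by rw [h1]; exact le_add_of_nonneg_right (sq_nonneg _)) (norm_nonneg _)
    · exact le_of_sq_le_sq (by rw [h1]; exact le_add_of_nonneg_left (sq_nonneg _)) (norm_nonneg _)
  · have h1 := GraphSpace.norm_le (pow_isSelfAdjoint hA n) (toPowSpace hA n x)
    have h2 : GraphSpace.incl (pow_isSelfAdjoint hA n) (toPowSpace hA n x) = SmoothSpace.val A x := rfl
    have h3 : GraphSpace.op (pow_isSelfAdjoint hA n) (toPowSpace hA n x) =
      SmoothSpace.val A ((SmoothSpace.op A ^ n) x) := (SmoothSpace.val_op_pow A n x).symm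
    rw [h2, h3] at h1
    have h4 := SmoothSpace.norm_op_pow_le hA n x
    have h5 := SmoothSpace.norm_le_subI_pow hA n x
    nlinarith [norm_nonneg (SmoothSpace.val A ((SmoothSpace.subI hA ^ (n : ℤ)) x))]

/-! ### The formal adjoint $A+i$ of $A-i$. -/

theorem SmoothSpace.addI_surjective (hA : IsSelfAdjoint A) :
    Function.Surjective (SmoothSpace.addI A) :=
  SmoothSpace.op_sub_surjective hA (by simp)

theorem SmoothSpace.addI_pow_surjective (hA : IsSelfAdjoint A) (n : ℕ) :
    Function.Surjective (SmoothSpace.addI A ^ n) := by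
  rw [Module.End.coe_pow]
  exact (SmoothSpace.addI_surjective hA).iterate n

theorem SmoothSpace.norm_addI (hA : IsSelfAdjoint A) (x : SmoothSpace A) :
    ‖SmoothSpace.val A (SmoothSpace.addI A x)‖ = ‖SmoothSpace.val A (SmoothSpace.subI hA x)‖ := by
  refine (sq_eq_sq₀ (norm_nonneg _) (norm_nonneg _)).1 ?_
  rw [SmoothSpace.norm_subI_sq, SmoothSpace.addI_apply,
    SmoothSpace.norm_op_sub_sq hA (by simp)]
  simp

theorem SmoothSpace.subI_zpow_addI (hA : IsSelfAdjoint A) (m : ℤ) (x : SmoothSpace A) :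
    (SmoothSpace.subI hA ^ m) (SmoothSpace.addI A x) =
      SmoothSpace.addI A ((SmoothSpace.subI hA ^ m) x) := by
  rw [SmoothSpace.addI_apply, SmoothSpace.addI_apply, map_sub, map_smul, SmoothSpace.subI_zpow_op]

theorem SmoothSpace.subI_zpow_addI_pow (hA : IsSelfAdjoint A) (m : ℤ) (n : ℕ) (x : SmoothSpace A) :
    (SmoothSpace.subI hA ^ m) ((SmoothSpace.addI A ^ n) x) =
      (SmoothSpace.addI A ^ n) ((SmoothSpace.subI hA ^ m) x) := by
  induction n with
  | zero => rfl
  | succ n ih =>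
    rw [pow_succ', Module.End.mul_apply, Module.End.mul_apply, ← ih, SmoothSpace.subI_zpow_addI]

/-- The factors $A\pm i$ commute and have equal norms on each vector, so they can be exchanged one
by one. -/
theorem SmoothSpace.norm_addI_pow (hA : IsSelfAdjoint A) (n : ℕ) (x : SmoothSpace A) :
    ‖SmoothSpace.val A ((SmoothSpace.addI A ^ n) x)‖ =
      ‖SmoothSpace.val A ((SmoothSpace.subI hA ^ (n : ℤ)) x)‖ := by
  induction n generalizing x with
  | zero => rfl
  | succ n ih =>
    have h := SmoothSpace.subI_zpow_addI_pow hA 1 n x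
    rw [zpow_one] at h
    rw [pow_succ', Module.End.mul_apply, SmoothSpace.norm_addI hA, h, ih, Nat.cast_succ,
      SmoothSpace.subI_zpow_add, zpow_one]

theorem SmoothSpace.inner_subI_pow (hA : IsSelfAdjoint A) (n : ℕ) (x y : SmoothSpace A) :
    (inner ℂ (SmoothSpace.val A ((SmoothSpace.subI hA ^ (n : ℤ)) x)) (SmoothSpace.val A y) : ℂ) =
      inner ℂ (SmoothSpace.val A x) (SmoothSpace.val A ((SmoothSpace.addI A ^ n) y)) := by
  induction n generalizing y with
  | zero => rfl
  | succ n ih =>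
    rw [Nat.cast_succ, add_comm (n : ℤ), SmoothSpace.subI_zpow_one_add, pow_succ,
      Module.End.mul_apply, ← ih, SmoothSpace.subI_apply, SmoothSpace.addI_apply, map_sub, map_sub,
      map_smul, map_smul, inner_sub_left, inner_sub_right, inner_smul_left, inner_smul_right,
      SmoothSpace.inner_op hA, Complex.conj_I]

end SmoothEndomorphisms

/-! ### Inclusions and extensions between Hilbert interspaces. -/

section Interspaces

variable {H : Type u} [NormedAddCommGroup H] [InnerProductSpace ℂ H] {R : RiggedSpace H}
  {E F : HilbertInterspace R}

theorem HilbertInterspace.identity_fromD (h : E.Sub F) (x : R.D) :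
    HilbertInterspace.identity h (E.fromD x) = F.fromD x :=
  F.toDual_injective <| by
    rw [HilbertInterspace.toDual_identity, E.toDual_fromD, F.toDual_fromD]

/-- The inclusion of one Hilbert interspace in another is continuous, by the closed graph
theorem. -/
theorem HilbertInterspace.continuous_identity (h : E.Sub F) :
    Continuous (HilbertInterspace.identity h) := by
  refine LinearMap.continuous_of_seq_closed_graph (HilbertInterspace.identity h)
    fun u x y hu hv => F.toDual_injective ?_
  -- Both spaces embed continuously in the Hausdorff space $\mathcal D^\times$, where the two limits
  -- must coincide.
  have h1 := (F.toDual.continuous.tendsto y).comp hv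
  have h2 := (E.toDual.continuous.tendsto x).comp hu
  rw [HilbertInterspace.toDual_identity]
  refine tendsto_nhds_unique h1 (h2.congr fun n => ?_)
  exact (HilbertInterspace.toDual_identity h (u n)).symm

theorem HilbertInterspace.exists_norm_fromD_le (h : E.Sub F) :
    ∃ C : ℝ, 0 < C ∧ ∀ x : R.D, ‖F.fromD x‖ ≤ C * ‖E.fromD x‖ := by
  obtain ⟨C, hC, hb⟩ := (⟨HilbertInterspace.identity h,
    HilbertInterspace.continuous_identity h⟩ : E.E →L[ℂ] F.E).bound
  refine ⟨C, hC, fun x => ?_⟩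
  rw [← HilbertInterspace.identity_fromD h]
  exact hb _

theorem continuous_shifted (h : E.Sub F) (Y : E.E →L[ℂ] F.E) (lam : ℂ) :
    Continuous (shifted h Y lam) :=
  Y.continuous.sub ((HilbertInterspace.continuous_identity h).const_smul lam)

/-- If `X` maps `D` into `D`, then so do its extensions. -/
theorem IsExtension.apply_fromD {X : R.D →L[ℂ] ConjDual R.D} {Y : E.E →L[ℂ] F.E}
    (hY : IsExtension X Y) {x y : R.D} (hX : X x = R.embed (R.incl y)) :
    Y (E.fromD x) = F.fromD y :=
  F.toDual_injective <| by rw [hY, hX, F.toDual_fromD]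

end Interspaces

/-! ### The norms of the Hilbert scale on $\mathcal D^\infty(A)$. -/

variable {H : Type u} [NormedAddCommGroup H] [InnerProductSpace ℂ H] [CompleteSpace H]
  {A : H →ₗ.[ℂ] H}

/-- The inequality is closed in the test vector, so it extends from the dense range to $v$ itself,
where it reads $\|v\|^2\le M\|v\|$. -/
theorem norm_le_of_forall_inner_le {K ι : Type*} [NormedAddCommGroup K] [InnerProductSpace ℂ K]
    {i : ι → K} (hi : DenseRange i) {v : K} {M : ℝ} (hM : 0 ≤ M)
    (h : ∀ x, ‖(inner ℂ (i x) v : ℂ)‖ ≤ M * ‖i x‖) : ‖v‖ ≤ M := by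
  have h1 : ‖(inner ℂ v v : ℂ)‖ ≤ M * ‖v‖ :=
    hi.induction_on v (p := fun w => ‖(inner ℂ w v : ℂ)‖ ≤ M * ‖w‖)
      (isClosed_le (continuous_id.inner continuous_const).norm
        (continuous_const.mul continuous_norm)) h
  rw [inner_self_eq_norm_sq_to_K (𝕜 := ℂ), norm_pow, RCLike.norm_ofReal, abs_norm] at h1
  rcases eq_or_lt_of_le (norm_nonneg v) with h0 | h0
  · rwa [← h0]
  · refine le_of_mul_le_mul_right ?_ h0
    rwa [← sq]

/-- Let $J:D(A^n)\to\mathcal H$ be the inclusion. Pairing $J^*(A+i)^nz$ with $x\in\mathcal D$ gives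
$\langle (A-i)^nx,z\rangle$, and $\|x\|_n$ is equivalent to $\|(A-i)^nx\|$, so duality makes
$\|J^*(A+i)^nz\|$ equivalent to $\|z\|$. -/
theorem norm_adjoint_incl_addI_pow (hA : IsSelfAdjoint A) (n : ℕ) :
    ∃ C : ℝ, 0 < C ∧ ∀ z : SmoothSpace A,
      ‖SmoothSpace.val A z‖ ≤ C * ‖ContinuousLinearMap.adjoint
        (GraphSpace.incl (pow_isSelfAdjoint hA n)) (SmoothSpace.val A ((SmoothSpace.addI A ^ n) z))‖ ∧
      ‖ContinuousLinearMap.adjoint (GraphSpace.incl (pow_isSelfAdjoint hA n))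
        (SmoothSpace.val A ((SmoothSpace.addI A ^ n) z))‖ ≤ C * ‖SmoothSpace.val A z‖ := by
  obtain ⟨C, hC, h⟩ := toPowSpace_norm_equiv hA n
  refine ⟨C, hC, fun z => ?_⟩
  set v := ContinuousLinearMap.adjoint (GraphSpace.incl (pow_isSelfAdjoint hA n))
    (SmoothSpace.val A ((SmoothSpace.addI A ^ n) z)) with hv
  have key : ∀ x : SmoothSpace A, (inner ℂ (toPowSpace hA n x) v : ℂ) =
      inner ℂ (SmoothSpace.val A ((SmoothSpace.subI hA ^ (n : ℤ)) x)) (SmoothSpace.val A z) := by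
    intro x
    rw [hv, ContinuousLinearMap.adjoint_inner_right, SmoothSpace.inner_subI_pow]
    rfl
  constructor
  -- The test vector $(A-i)^{-n}z$ turns the pairing into $\|z\|^2$.
  · have h1 := key ((SmoothSpace.subI hA ^ (-(n : ℤ))) z)
    have h2 := (h ((SmoothSpace.subI hA ^ (-(n : ℤ))) z)).2
    rw [SmoothSpace.subI_zpow_neg] at h1 h2
    have h3 := norm_inner_le_norm (𝕜 := ℂ)
      (toPowSpace hA n ((SmoothSpace.subI hA ^ (-(n : ℤ))) z)) v
    rw [h1, inner_self_eq_norm_sq_to_K, norm_pow, RCLike.norm_ofReal, abs_norm] at h3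
    rcases eq_or_lt_of_le (norm_nonneg (SmoothSpace.val A z)) with h0 | h0
    · rw [← h0]
      positivity
    · refine le_of_mul_le_mul_left ?_ h0
      nlinarith [norm_nonneg v, mul_le_mul_of_nonneg_right h2 (norm_nonneg v)]
  · refine norm_le_of_forall_inner_le (toPowSpace_dense hA n) (by positivity) fun x => ?_
    rw [key]
    refine (norm_inner_le_norm _ _).trans ?_
    nlinarith [mul_le_mul_of_nonneg_right (h x).1 (norm_nonneg (SmoothSpace.val A z))]

theorem norm_scaleNeg_fromD (hA : IsSelfAdjoint A) (n : ℕ) (x : SmoothSpace A) :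
    ‖(scaleNeg hA n).fromD x‖ = ‖ContinuousLinearMap.adjoint
      (GraphSpace.incl (pow_isSelfAdjoint hA n)) (SmoothSpace.val A x)‖ := by
  rw [← norm_invSqrtOneAddSq, ← NegSpace.norm_eq]
  exact UniformSpace.Completion.norm_coe _

/-- Every $x\in\mathcal D$ is $(A+i)^nz$, and $\|(A-i)^{-n}(A+i)^nz\|=\|z\|$; the dual estimate for
$(A+i)^nz$ then applies. -/
theorem scaleNeg_norm_equiv (hA : IsSelfAdjoint A) (n : ℕ) :
    ∃ C : ℝ, 0 < C ∧ ∀ x : SmoothSpace A,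
      ‖SmoothSpace.val A ((SmoothSpace.subI hA ^ (-(n : ℤ))) x)‖ ≤ C * ‖(scaleNeg hA n).fromD x‖ ∧
      ‖(scaleNeg hA n).fromD x‖ ≤
        C * ‖SmoothSpace.val A ((SmoothSpace.subI hA ^ (-(n : ℤ))) x)‖ := by
  obtain ⟨C, hC, h⟩ := norm_adjoint_incl_addI_pow hA n
  refine ⟨C, hC, fun x => ?_⟩
  obtain ⟨z, rfl⟩ := SmoothSpace.addI_pow_surjective hA n x
  rw [norm_scaleNeg_fromD, SmoothSpace.subI_zpow_addI_pow, SmoothSpace.norm_addI_pow hA,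
    SmoothSpace.subI_zpow_neg]
  exact h z

/-- On `D^∞(A)`, the norm of `ℋ_n` is equivalent to `‖(A - i)ⁿ ξ‖`. -/
theorem scale_norm_equiv (hA : IsSelfAdjoint A) (n : ℤ) :
    ∃ C : ℝ, 0 < C ∧ ∀ x : SmoothSpace A,
      ‖SmoothSpace.val A ((SmoothSpace.subI hA ^ n) x)‖ ≤ C * ‖(scale hA n).fromD x‖ ∧
      ‖(scale hA n).fromD x‖ ≤ C * ‖SmoothSpace.val A ((SmoothSpace.subI hA ^ n) x)‖ := by
  match n with
  | .ofNat 0 => exact ⟨1, one_pos, fun x => by rw [one_mul, one_mul]; exact ⟨le_rfl, le_rfl⟩⟩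
  | .ofNat (n + 1) => exact toPowSpace_norm_equiv hA (n + 1)
  | .negSucc n => exact scaleNeg_norm_equiv hA (n + 1)

/-! ### From estimates on $\mathcal D^\infty(A)$ to the closed operator $A$. -/

/-- Any $x\in\mathcal H$ is a limit of smoothed vectors $s_k$; the bound makes $As_k$ Cauchy, and
closedness of $A$ puts $x$ in its domain. -/
theorem domain_eq_top_of_subI_bounded (hA : IsSelfAdjoint A) {C : ℝ}
    (h : ∀ x, ‖SmoothSpace.val A (SmoothSpace.subI hA x)‖ ≤ C * ‖SmoothSpace.val A x‖) :
    A.domain = ⊤ := by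
  refine Submodule.eq_top_iff'.2 fun x => ?_
  let s : ℕ → SmoothSpace A := fun k => ⟨_, smoothing_mem_smooth hA (k + 1) x⟩
  have hs : Filter.Tendsto (fun k => SmoothSpace.val A (s k)) Filter.atTop (nhds x) :=
    smoothing_tendsto hA x
  have hc : CauchySeq fun k => SmoothSpace.val A (SmoothSpace.op A (s k)) := by
    have h1 := Metric.cauchySeq_iff.1 hs.cauchySeq
    refine Metric.cauchySeq_iff.2 fun ε hε => ?_
    -- The sign of $C$ is not known, so $|C|+1$ provides a positive denominator.
    obtain ⟨N, hN⟩ := h1 (ε / (|C| + 1)) (by positivity)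
    refine ⟨N, fun i hi j hj => ?_⟩
    have h2 := hN i hi j hj
    rw [dist_eq_norm, ← map_sub, lt_div_iff₀ (by positivity)] at h2
    rw [dist_eq_norm, ← map_sub, ← map_sub]
    have h3 := (SmoothSpace.norm_op_le hA (s i - s j)).trans (h _)
    nlinarith [norm_nonneg (SmoothSpace.val A (s i - s j)), le_abs_self C]
  obtain ⟨y, hy⟩ := cauchySeq_tendsto_of_complete hc
  have hcA : IsClosed (A.graph : Set (H × H)) := hA.isClosed
  exact mem_domain_of_graph (hcA.mem_of_tendsto (hs.prodMk_nhds hy)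
    (Filter.Eventually.of_forall fun k => SmoothSpace.op_graph A (s k)))

/-- $\mathcal D^\infty(A)$ is a core for $A$: the smoothing operators commute with $A$, so both
coordinates of a graph point are approximated at once. -/
theorem SmoothSpace.exists_tendsto (hA : IsSelfAdjoint A) {x y : H} (h : (x, y) ∈ A.graph) :
    ∃ s : ℕ → SmoothSpace A,
      Filter.Tendsto (fun k => SmoothSpace.val A (s k)) Filter.atTop (nhds x) ∧
      Filter.Tendsto (fun k => SmoothSpace.val A (SmoothSpace.op A (s k))) Filter.atTop (nhds y) := by
  refine ⟨fun k => ⟨_, smoothing_mem_smooth hA (k + 1) x⟩, smoothing_tendsto hA x, ?_⟩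
  refine (smoothing_tendsto hA y).congr fun k => ?_
  have h1 := (mem_powPMap_one A _ _).1
    (smoothing_graph hA (k + 1) 1 ((mem_powPMap_one A _ _).2 h))
  exact graph_unique h1 (SmoothSpace.op_graph A ⟨_, smoothing_mem_smooth hA (k + 1) x⟩)

/-- A number `lam` for which `A - lam` is bounded below on `D^∞(A)`, with dense range, belongs to
the resolvent set. -/
theorem mem_operatorResolventSet (hA : IsSelfAdjoint A) {lam : ℂ} {C : ℝ}
    (hb : ∀ x, ‖SmoothSpace.val A x‖ ≤ C * ‖SmoothSpace.val A (SmoothSpace.op A x - lam • x)‖)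
    (hd : DenseRange fun x => SmoothSpace.val A (SmoothSpace.op A x - lam • x)) :
    lam ∈ operatorResolventSet A := by
  -- The lower bound passes from the core to all of $D(A)$.
  have hb' : ∀ x : A.domain, ‖(x : H)‖ ≤ C * ‖A x - lam • (x : H)‖ := by
    intro x
    obtain ⟨s, h1, h2⟩ := SmoothSpace.exists_tendsto hA (A.mem_graph x)
    refine le_of_tendsto_of_tendsto' h1.norm (((h2.sub (h1.const_smul lam)).norm).const_mul C)
      fun k => ?_
    have := hb (s k)
    rwa [map_sub, map_smul] at this
  let T : A.domain →ₗ[ℂ] H := A.toFun - lam • A.domain.subtype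
  have hT : ∀ x : A.domain, T x = A x - lam • (x : H) := fun x => rfl
  have hinj : Function.Injective T := by
    rw [injective_iff_map_eq_zero]
    intro x hx
    have h := hb' x
    rw [← hT, hx, norm_zero, mul_zero] at h
    exact Subtype.ext (norm_le_zero_iff.1 h)
  have hsurj : Function.Surjective T := by
    intro y
    obtain ⟨u, hu, hlim⟩ := mem_closure_iff_seq_limit.1 (hd y)
    choose s hs using hu
    -- Closed range: the lower bound makes the preimages Cauchy, and the closed graph identifies the
    -- limit as a preimage of $y$.
    have hc : CauchySeq fun k => SmoothSpace.val A (s k) := by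
      have h1 := Metric.cauchySeq_iff.1 hlim.cauchySeq
      refine Metric.cauchySeq_iff.2 fun ε hε => ?_
      obtain ⟨N, hN⟩ := h1 (ε / (|C| + 1)) (by positivity)
      refine ⟨N, fun i hi j hj => ?_⟩
      have h2 := hN i hi j hj
      have h3 := hb (s i - s j)
      rw [map_sub (SmoothSpace.op A), smul_sub, sub_sub_sub_comm, map_sub, map_sub] at h3
      rw [dist_eq_norm, ← hs, ← hs, lt_div_iff₀ (by positivity)] at h2
      rw [dist_eq_norm]
      dsimp only at h2
      nlinarith [norm_nonneg (SmoothSpace.val A (SmoothSpace.op A (s i) - lam • s i) -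
        SmoothSpace.val A (SmoothSpace.op A (s j) - lam • s j)), le_abs_self C]
    obtain ⟨x, hx⟩ := cauchySeq_tendsto_of_complete hc
    have h1 : Filter.Tendsto (fun k => SmoothSpace.val A (SmoothSpace.op A (s k))) Filter.atTop
        (nhds (y + lam • x)) := by
      refine (hlim.add (hx.const_smul lam)).congr fun k => ?_
      rw [← hs]
      dsimp only
      rw [map_sub, map_smul, sub_add_cancel]
    have hcA : IsClosed (A.graph : Set (H × H)) := hA.isClosed
    have h2 : (x, y + lam • x) ∈ A.graph := hcA.mem_of_tendsto (hx.prodMk_nhds h1)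
      (Filter.Eventually.of_forall fun k => SmoothSpace.op_graph A (s k))
    refine ⟨⟨x, mem_domain_of_graph h2⟩, ?_⟩
    rw [hT, graph_apply h2]
    exact add_sub_cancel_right _ _
  let e : A.domain ≃ₗ[ℂ] H := LinearEquiv.ofBijective T ⟨hinj, hsurj⟩
  have he : ∀ x : A.domain, e x = A x - lam • (x : H) := fun x => rfl
  let Z : H →L[ℂ] H := (A.domain.subtype ∘ₗ e.symm.toLinearMap).mkContinuous C fun y => by
    have h := hb' (e.symm y)
    rwa [← he, e.apply_symm_apply] at h
  refine ⟨Z, fun x => ?_, fun y => ⟨e.symm y, rfl, ?_⟩⟩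
  · rw [← he]
    exact congrArg Subtype.val (e.symm_apply_apply x)
  · rw [← he, e.apply_symm_apply]

/-! ### Inclusions and inverses in the scale as estimates in $\mathcal H$. -/

theorem restriction_eq_embed (hA : IsSelfAdjoint A) (x : SmoothSpace A) :
    restriction hA x = (riggedSpace hA).embed ((riggedSpace hA).incl (SmoothSpace.op A x)) := rfl

theorem extension_apply (hA : IsSelfAdjoint A) {E F : HilbertInterspace (riggedSpace hA)}
    {Y : E.E →L[ℂ] F.E} (hY : IsExtension (restriction hA) Y) (x : SmoothSpace A) :
    Y (E.fromD x) = F.fromD (SmoothSpace.op A x) :=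
  hY.apply_fromD (restriction_eq_embed hA x)

theorem shifted_fromD (hA : IsSelfAdjoint A) {E F : HilbertInterspace (riggedSpace hA)}
    (h : E.Sub F) {Y : E.E →L[ℂ] F.E} (hY : IsExtension (restriction hA) Y) (lam : ℂ)
    (x : SmoothSpace A) :
    shifted h Y lam (E.fromD x) = F.fromD (SmoothSpace.op A x - lam • x) := by
  have h1 := extension_apply hA hY x
  have h2 := HilbertInterspace.identity_fromD h x
  exact (congrArg₂ (fun p q => p - lam • q) h1 h2).trans
    ((F.fromD.map_sub _ _).trans (congrArg _ (F.fromD.map_smul lam _))).symm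

variable {n m : ℤ}

/-- The embedding `ℋ_n ⊆ ℋ_m` expressed by a norm inequality on `D^∞(A)`. -/
theorem norm_le_of_scale_sub (hA : IsSelfAdjoint A) (h : (scale hA n).Sub (scale hA m)) :
    ∃ C : ℝ, 0 < C ∧ ∀ x, ‖SmoothSpace.val A x‖ ≤
      C * ‖SmoothSpace.val A ((SmoothSpace.subI hA ^ (n - m)) x)‖ := by
  obtain ⟨C, hC, hb⟩ := HilbertInterspace.exists_norm_fromD_le h
  obtain ⟨C₁, hC₁, h1⟩ := scale_norm_equiv hA n
  obtain ⟨C₂, hC₂, h2⟩ := scale_norm_equiv hA m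
  refine ⟨C₂ * (C * C₁), by positivity, fun x => ?_⟩
  -- Evaluating at $(A-i)^{-m}x$ shifts the pair of exponents $(n,m)$ to $(n-m,0)$.
  have h3 := (h2 ((SmoothSpace.subI hA ^ (-m)) x)).1
  have h4 := (h1 ((SmoothSpace.subI hA ^ (-m)) x)).2
  rw [SmoothSpace.subI_zpow_neg] at h3
  rw [← SmoothSpace.subI_zpow_add, ← sub_eq_add_neg] at h4
  refine h3.trans ?_
  rw [mul_assoc, mul_assoc]
  exact mul_le_mul_of_nonneg_left ((hb _).trans (mul_le_mul_of_nonneg_left h4 hC.le)) hC₂.le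

/-- At $(A-i)^{m-n}x$ the inclusion estimate reads $\|(A-i)^{m-n}x\|\le C\|x\|$. Since $A-i$ does
not decrease norms and $m-n\ge1$, the left side dominates $\|(A-i)x\|$. -/
theorem subI_bounded_of_scale_sub (hA : IsSelfAdjoint A) (h : (scale hA n).Sub (scale hA m))
    (hnm : n < m) :
    ∃ C : ℝ, 0 < C ∧ ∀ x, ‖SmoothSpace.val A (SmoothSpace.subI hA x)‖ ≤ C * ‖SmoothSpace.val A x‖ := by
  obtain ⟨C, hC, hb⟩ := norm_le_of_scale_sub hA h
  refine ⟨C, hC, fun x => ?_⟩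
  obtain ⟨k, hk⟩ := Int.eq_ofNat_of_zero_le (show 0 ≤ m - n - 1 by omega)
  have h1 := SmoothSpace.norm_le_subI_pow hA k (SmoothSpace.subI hA x)
  have h2 := hb ((SmoothSpace.subI hA ^ (m - n)) x)
  rw [← SmoothSpace.subI_zpow_add, show n - m + (m - n) = 0 by ring, zpow_zero] at h2
  refine h1.trans ?_
  rw [← hk]
  have h3 := SmoothSpace.subI_zpow_add hA (m - n - 1) 1 x
  rw [zpow_one, sub_add_cancel] at h3
  rw [← h3]
  exact h2

/-- The bound of $Z$ is applied to $(S-\lambda)w$ with $w=(A-i)^{-m}x$; as $A$ commutes with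
$(A-i)^m$, the $\mathcal H_m$-norm of this vector is comparable to $\|(A-\lambda)x\|$. -/
theorem norm_subI_zpow_le_of_leftInverse (hA : IsSelfAdjoint A)
    {h : (scale hA n).Sub (scale hA m)} {Y : (scale hA n).E →L[ℂ] (scale hA m).E}
    (hY : IsExtension (restriction hA) Y) {lam : ℂ} {Z : (scale hA m).E →L[ℂ] (scale hA n).E}
    (hZ : ∀ e, Z (shifted h Y lam e) = e) :
    ∃ C : ℝ, 0 < C ∧ ∀ x, ‖SmoothSpace.val A ((SmoothSpace.subI hA ^ (n - m)) x)‖ ≤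
      C * ‖SmoothSpace.val A (SmoothSpace.op A x - lam • x)‖ := by
  obtain ⟨C, hC, hb⟩ := Z.bound
  obtain ⟨C₁, hC₁, h1⟩ := scale_norm_equiv hA n
  obtain ⟨C₂, hC₂, h2⟩ := scale_norm_equiv hA m
  refine ⟨C₁ * (C * C₂), by positivity, fun x => ?_⟩
  set w := (SmoothSpace.subI hA ^ (-m)) x with hw
  have h3 := (h1 w).1
  have h4 := (h2 (SmoothSpace.op A w - lam • w)).2
  rw [map_sub, map_smul, SmoothSpace.subI_zpow_op, hw, SmoothSpace.subI_zpow_neg] at h4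
  rw [hw, ← SmoothSpace.subI_zpow_add, ← sub_eq_add_neg] at h3
  have h5 := hb (shifted h Y lam ((scale hA n).fromD w))
  rw [hZ, shifted_fromD hA h hY] at h5
  refine h3.trans ?_
  rw [mul_assoc, mul_assoc]
  exact mul_le_mul_of_nonneg_left (h5.trans (mul_le_mul_of_nonneg_left h4 hC.le)) hC₁.le

/-- $(A-i)^n$ carries the norm of $\mathcal H_n$ to that of $\mathcal H$ and commutes with $A$, so
boundedness on one level of the scale gives boundedness on level $0$. -/
theorem norm_op_le_of_extension (hA : IsSelfAdjoint A)
    {Y : (scale hA n).E →L[ℂ] (scale hA n).E} (hY : IsExtension (restriction hA) Y) :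
    ∃ C : ℝ, 0 < C ∧ ∀ x, ‖SmoothSpace.val A (SmoothSpace.op A x)‖ ≤ C * ‖SmoothSpace.val A x‖ := by
  obtain ⟨C, hC, hb⟩ := Y.bound
  obtain ⟨C₁, hC₁, h1⟩ := scale_norm_equiv hA n
  refine ⟨C₁ * (C * C₁), by positivity, fun x => ?_⟩
  set w := (SmoothSpace.subI hA ^ (-n)) x with hw
  have h3 := (h1 (SmoothSpace.op A w)).1
  have h4 := (h1 w).2
  rw [SmoothSpace.subI_zpow_op, hw, SmoothSpace.subI_zpow_neg] at h3
  rw [hw, SmoothSpace.subI_zpow_neg] at h4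
  have h5 := hb ((scale hA n).fromD w)
  rw [extension_apply hA hY] at h5
  refine h3.trans ?_
  rw [mul_assoc, mul_assoc]
  exact mul_le_mul_of_nonneg_left (h5.trans (mul_le_mul_of_nonneg_left h4 hC.le)) hC₁.le

/-- Surjectivity, continuity and density of $\mathcal D$ make $(A-\lambda)\mathcal D$ dense in
$\mathcal H_m$; transport by $(A-i)^m$, which commutes with $A-\lambda$, makes it dense in $\mathcal
H$. -/
theorem denseRange_op_sub (hA : IsSelfAdjoint A) {h : (scale hA n).Sub (scale hA m)}
    {Y : (scale hA n).E →L[ℂ] (scale hA m).E} (hY : IsExtension (restriction hA) Y) {lam : ℂ}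
    (hs : Function.Surjective (shifted h Y lam)) :
    DenseRange fun x => SmoothSpace.val A (SmoothSpace.op A x - lam • x) := by
  obtain ⟨C, hC, hb⟩ := scale_norm_equiv hA m
  have hd := hs.denseRange.comp (scale hA n).dense_fromD (continuous_shifted h Y lam)
  have hD : DenseRange (SmoothSpace.val A) := (riggedSpace hA).incl_dense
  -- It suffices that the closure of the range contains the dense subspace $\mathcal D$.
  rw [DenseRange, ← dense_closure]
  refine hD.mono ?_
  rintro _ ⟨y, rfl⟩
  refine Metric.mem_closure_iff.2 fun ε hε => ?_
  obtain ⟨(x : SmoothSpace A), hx⟩ := hd.exists_dist_lt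
    ((scale hA m).fromD ((SmoothSpace.subI hA ^ (-m)) y)) (show 0 < ε / C by positivity)
  refine ⟨_, ⟨(SmoothSpace.subI hA ^ m) x, rfl⟩, ?_⟩
  replace hx := lt_of_eq_of_lt (congrArg (dist _) (shifted_fromD hA h hY lam x).symm) hx
  rw [dist_eq_norm] at hx ⊢
  have h1 := (hb ((SmoothSpace.subI hA ^ (-m)) y - (SmoothSpace.op A x - lam • x))).1
  rw [map_sub (SmoothSpace.subI hA ^ m), map_sub (SmoothSpace.subI hA ^ m), map_smul,
    SmoothSpace.subI_zpow_op, SmoothSpace.subI_zpow_neg, map_sub (SmoothSpace.val A)] at h1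
  refine h1.trans_lt ?_
  rw [lt_div_iff₀' hC] at hx
  exact lt_of_eq_of_lt (congrArg (fun f => C * ‖f‖) ((scale hA m).fromD.map_sub _ _)) hx

/-- $\|(A-i)^{n-m}x\|$ is the middle term: bounded below by the inclusion and above by the inverse,
it eliminates $n$ and $m$. -/
theorem norm_le_of_leftInverse (hA : IsSelfAdjoint A)
    {h : (scale hA n).Sub (scale hA m)} {Y : (scale hA n).E →L[ℂ] (scale hA m).E}
    (hY : IsExtension (restriction hA) Y) {lam : ℂ} {Z : (scale hA m).E →L[ℂ] (scale hA n).E}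
    (hZ : ∀ e, Z (shifted h Y lam e) = e) :
    ∃ C : ℝ, 0 < C ∧ ∀ x, ‖SmoothSpace.val A x‖ ≤
      C * ‖SmoothSpace.val A (SmoothSpace.op A x - lam • x)‖ := by
  obtain ⟨C₁, hC₁, h1⟩ := norm_le_of_scale_sub hA h
  obtain ⟨C₂, hC₂, h2⟩ := norm_subI_zpow_le_of_leftInverse hA hY hZ
  refine ⟨C₁ * C₂, by positivity, fun x => (h1 x).trans ?_⟩
  rw [mul_assoc]
  exact mul_le_mul_of_nonneg_left (h2 x) hC₁.le

/-- If `S - lam` is invertible from `ℋ_n` to `ℋ_m` with `n - m ≠ 1`, then `A` is bounded. -/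
theorem domain_eq_top_of_leftInverse (hA : IsSelfAdjoint A)
    {h : (scale hA n).Sub (scale hA m)} {Y : (scale hA n).E →L[ℂ] (scale hA m).E}
    (hY : IsExtension (restriction hA) Y) {lam : ℂ} {Z : (scale hA m).E →L[ℂ] (scale hA n).E}
    (hZ : ∀ e, Z (shifted h Y lam e) = e) (hnm : m ≠ n - 1) : A.domain = ⊤ := by
  rcases lt_trichotomy n m with hlt | rfl | hgt
  · obtain ⟨C, -, hC⟩ := subI_bounded_of_scale_sub hA h hlt
    exact domain_eq_top_of_subI_bounded hA hC
  -- Here continuity of the extension alone bounds $A$; the inverse plays no role.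
  · obtain ⟨C, -, hC⟩ := norm_op_le_of_extension hA hY
    refine domain_eq_top_of_subI_bounded hA (C := C + 1) fun x => ?_
    have := SmoothSpace.norm_subI_le hA x
    linarith [hC x]
  · obtain ⟨C, hC, hb⟩ := norm_subI_zpow_le_of_leftInverse hA hY hZ
    obtain ⟨k, hk⟩ := Int.eq_ofNat_of_zero_le (show 0 ≤ n - m - 2 by omega)
    -- With $y=(A-i)x$ and $n-m\ge2$, $\|(A-i)y\|\le\|(A-i)^{n-m}x\|\le C\|(A-\lambda)x\|\le
    -- C(1+|\lambda|)\|y\|$.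
    refine domain_eq_top_of_subI_bounded hA (C := C * (1 + ‖lam‖)) fun y => ?_
    have h1 := SmoothSpace.norm_le_subI_pow hA k (SmoothSpace.subI hA y)
    obtain ⟨x, rfl⟩ := (SmoothSpace.subI hA).surjective y
    have h2 : (SmoothSpace.subI hA ^ (k : ℤ)) (SmoothSpace.subI hA (SmoothSpace.subI hA x)) =
        (SmoothSpace.subI hA ^ (n - m)) x := by
      rw [show n - m = k + 1 + 1 by omega, SmoothSpace.subI_zpow_add, SmoothSpace.subI_zpow_add,
        zpow_one]
    rw [h2] at h1
    refine (h1.trans (hb x)).trans ?_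
    rw [mul_assoc]
    refine mul_le_mul_of_nonneg_left ?_ hC.le
    rw [map_sub, map_smul]
    refine (norm_sub_le _ _).trans ?_
    rw [norm_smul, add_mul, one_mul]
    exact add_le_add (SmoothSpace.norm_op_le hA x)
      (mul_le_mul_of_nonneg_left (SmoothSpace.norm_le_subI hA x) (norm_nonneg _))

/-! ### The pair $(\mathcal H_1,\mathcal H_0)$ and the conclusion. -/

theorem scale_one_sub_scale_zero (hA : IsSelfAdjoint A) : (scale hA 1).Sub (scale hA 0) := by
  rintro _ ⟨x, rfl⟩
  exact ⟨GraphSpace.incl (pow_isSelfAdjoint hA 1) x, rfl⟩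

theorem identity_scale_one (hA : IsSelfAdjoint A) (x : GraphSpace (pow_isSelfAdjoint hA 1)) :
    HilbertInterspace.identity (scale_one_sub_scale_zero hA) x =
      GraphSpace.incl (pow_isSelfAdjoint hA 1) x :=
  (scale hA 0).toDual_injective
    (HilbertInterspace.toDual_identity (scale_one_sub_scale_zero hA) x)

theorem mem_familyResolventSet (hA : IsSelfAdjoint A) {lam : ℂ}
    (hl : lam ∈ operatorResolventSet A) :
    lam ∈ familyResolventSet (Set.range (scale hA)) (restriction hA) := by
  obtain ⟨Z, hZ, hZ'⟩ := hl
  let hT := pow_isSelfAdjoint hA 1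
  have hsh : ∀ x : GraphSpace hT, shifted (scale_one_sub_scale_zero hA) (GraphSpace.op hT) lam x =
      GraphSpace.op hT x - lam • GraphSpace.incl hT x := fun x => by
    rw [← identity_scale_one hA x]
    rfl
  have hgr : ∀ y, (Z y, y + lam • Z y) ∈ (powPMap A 1).graph := fun y => by
    obtain ⟨x, hx, hx'⟩ := hZ' y
    refine (mem_powPMap_one A _ _).2 ?_
    rw [← hx, ← sub_eq_iff_eq_add.1 hx']
    exact A.mem_graph x
  -- The resolvent $Z$ is bounded into the graph norm because $AZy=y+\lambda Zy$; so
  -- $y\mapsto(Zy,\,y+\lambda Zy)$ is the inverse $\mathcal H_0\to\mathcal H_1$.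
  let L : H →L[ℂ] GraphSpace hT :=
    ((WithLp.prodContinuousLinearEquiv 2 ℂ H H).symm.toContinuousLinearMap ∘L
      (Z.prod (ContinuousLinearMap.id ℂ H + lam • Z))).codRestrict (graphSubmodule (powPMap A 1)) hgr
  have hi : ∀ y, GraphSpace.incl hT (L y) = Z y := fun y => rfl
  have ho : ∀ y, GraphSpace.op hT (L y) = y + lam • Z y := fun y => rfl
  have hrange : ∀ y, shifted (scale_one_sub_scale_zero hA) (GraphSpace.op hT) lam (L y) = y :=
    fun y => by rw [hsh, hi, ho, add_sub_cancel_right]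
  refine ⟨_, ⟨1, rfl⟩, _, ⟨0, rfl⟩, scale_one_sub_scale_zero hA, GraphSpace.op hT, fun x => rfl,
    fun y => ⟨L y, hrange y⟩, L, fun x => GraphSpace.incl_injective hT ?_⟩
  have hx := (mem_powPMap_one A _ _).1 (GraphSpace.graph hT x)
  have h1 := hZ ⟨_, mem_domain_of_graph hx⟩
  rw [graph_apply hx] at h1
  have h2 : GraphSpace.incl hT (L (GraphSpace.op hT x - lam • GraphSpace.incl hT x)) =
      GraphSpace.incl hT x := (hi _).trans h1
  exact (congrArg (fun y => GraphSpace.incl hT (L y)) (hsh x)).trans h2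

theorem familyResolventSet_scale (hA : IsSelfAdjoint A) :
    familyResolventSet (Set.range (scale hA)) (restriction hA) = operatorResolventSet A := by
  refine Set.Subset.antisymm ?_ fun lam => mem_familyResolventSet hA
  rintro lam ⟨_, ⟨n, rfl⟩, _, ⟨m, rfl⟩, h, Y, hY, hs, Z, hZ⟩
  obtain ⟨C, -, hC⟩ := norm_le_of_leftInverse hA hY hZ
  exact mem_operatorResolventSet hA hC (denseRange_op_sub hA hY hs)

theorem pairResolventSet_scale_eq_empty (hA : IsSelfAdjoint A) (hA' : A.domain ≠ ⊤)
    (hnm : m ≠ n - 1) : pairResolventSet (scale hA n) (scale hA m) (restriction hA) = ∅ := by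
  refine Set.eq_empty_of_forall_notMem ?_
  rintro lam ⟨h, Y, hY, Z, hZ, -⟩
  exact hA' (domain_eq_top_of_leftInverse hA hY hZ hnm)

end RiggedResolvent

theorem mainTheorem2 {H : Type*} [NormedAddCommGroup H] [InnerProductSpace ℂ H] [CompleteSpace H]
    (A : H →ₗ.[ℂ] H) (hA : IsSelfAdjoint A) :
    RiggedResolvent.familyResolventSet (Set.range (RiggedResolvent.scale hA))
        (RiggedResolvent.restriction hA) = RiggedResolvent.operatorResolventSet A ∧
      (A.domain ≠ ⊤ → ∀ n m : ℤ, m ≠ n - 1 →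
        RiggedResolvent.pairResolventSet (RiggedResolvent.scale hA n) (RiggedResolvent.scale hA m)
          (RiggedResolvent.restriction hA) = ∅) :=
  ⟨RiggedResolvent.familyResolventSet_scale hA,
    fun hA' _ _ hnm => RiggedResolvent.pairResolventSet_scale_eq_empty hA hA' hnm⟩
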